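/- Let $\mathbf{k}$ be a finite field with $q$ elements, of characteristic $p\neq 2$, and fix a non-trivial additive character $\psi\colon\mathbf{k}\to\mathbb{C}^*$. Let $\widehat{\mathbf{k}^*}=\mathrm{Hom}(\mathbf{k}^*,\mathbb{C}^*)$, with unit $\varepsilon$; every $\chi\in\widehat{\mathbf{k}^*}$ (including $\varepsilon$) is extended by $\chi(0)=0$, and $\overline{\chi}=\chi^{-1}$. Let $\phi$ be the quadratic character ($\phi^2=\varepsilon$, $\phi\ne\varepsilon$), and let $\delta(\varepsilon)=1$, $\delta(\chi)=0$ for $\chi\neq\varepsilon$. Put $$g(\chi)=-\sum_{x\in\mathbf{k}}\psi(x)\chi(x),\quad g^\circ(\chi)=q^{\delta(\chi)}g(\chi),\quad (\alpha)_\nu=\frac{g(\alpha\nu)}{g(\alpha)},\quad (\alpha)^\circ_\nu=\frac{g^\circ(\alpha\nu)}{g^\circ(\alpha)},$$ and, for $\lambda\in\mathbf{k}$, $${}_rF_s\left({\alpha_1,\dots,\alpha_r\atop\beta_1,\dots,\beta_s};\lambda\right)=\frac{1}{1-q}\sum_{\nu\in\widehat{\mathbf{k}^*}}\frac{\prod_{i=1}^r(\alpha_i)_\nu}{(\varepsilon)^\circ_\nu\prod_{j=1}^s(\beta_j)^\circ_\nu}\,\nu(\lambda).$$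 For formal sums of characters let $(\ ,\ )$ be the biadditive pairing with $(\alpha,\beta)=\delta(\alpha\overline{\beta})$ for $\alpha,\beta\in\widehat{\mathbf{k}^*}$ (so $(\alpha_1+\dots+\alpha_r,\beta_1+\dots+\beta_s)=0$ means that $\alpha_i\ne\beta_j$ for all $i,j$). Then for all $\alpha,\beta\in\widehat{\mathbf{k}^*}$ and all $\lambda\in\mathbf{k}$: (i) Without further condition, $${}_0F_1\left({\atop\alpha^2};\lambda\right){}_0F_1\left({\atop\overline{\alpha^2}};-\lambda\right)=q^{\delta(\alpha)}\,{}_0F_3\left({\atop\phi,\alpha\phi,\overline{\alpha}\phi};-\frac{\lambda^2}{4}\right).$$ (ii) If $(\alpha^2+\beta^2+\alpha^2\beta^2,\varepsilon)=0$, then $${}_2F_0\left({\alpha^2,\beta^2\atop};\lambda\right){}_2F_0\left({\alpha^2,\beta^2\atop};-\lambda\right)={}_4F_1\left({\alpha^2,\beta^2,\alpha\beta,\alpha\beta\phi\atop\alpha^2\beta^2};4\lambda^2\right).$$ (iii) If $(\alpha^2+\beta^2+\alpha^2\beta^2,\varepsilon)=(\alpha^2,\beta^2)=0$, then $${}_2F_0\left({\alpha^2,\overline{\alpha^2}\atop};\lambda\right){}_2F_0\left({\beta^2,\overline{\beta^2}\atop};-\lambda\right)={}_4F_1\left({\alpha\overline{\beta}\phi,\overline{\alpha}\beta\phi,\alpha\beta,\overline{\alpha\beta}\atop\phi};4\lambda^2\right).$$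 (iv) If $(\alpha,\varepsilon+\beta^2)=(\alpha^2,\beta^2)=0$, then $${}_1F_1\left({\alpha\atop\beta^2};\lambda\right){}_1F_1\left({\alpha\overline{\beta^2}\atop\overline{\beta^2}};-\lambda\right)=q^{\delta(\beta)}\,{}_2F_3\left({\alpha\overline{\beta}\phi,\overline{\alpha}\beta\phi\atop\phi,\beta\phi,\overline{\beta}\phi};\frac{\lambda^2}{4}\right).$$ (v) If $(\alpha^2+\beta^2+\alpha^2\beta^2,\varepsilon)=(\alpha^2,\beta^2)=0$, then $${}_1F_1\left({\alpha^2\atop\alpha^4};\lambda\right){}_1F_1\left({\beta^2\atop\beta^4};-\lambda\right)={}_2F_3\left({\alpha\beta,\alpha\beta\phi\atop\alpha^2\phi,\beta^2\phi,\alpha^2\beta^2};\frac{\lambda^2}{4}\right);$$ and if $(\alpha^2\phi+\beta^2\phi+\alpha^2\beta^2,\varepsilon)=(\alpha^2,\beta^2)=0$, then $${}_1F_1\left({\alpha^2\phi\atop\alpha^4};\lambda\right){}_1F_1\left({\beta^2\phi\atop\beta^4};-\lambda\right)={}_2F_3\left({\alpha\beta,\alpha\beta\phi\atop\alpha^2,\beta^2,\alpha^2\beta^2};\frac{\lambda^2}{4}\right).$$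 -/

import Mathlib

open Classical in
/-- The characteristic function `δ` of the unit multiplicative character. -/
noncomputable def charDelta {F : Type*} [Field F] (χ : MulChar F ℂ) : ℕ :=
  if χ = 1 then 1 else 0

/-- The Gauss sum `g(χ) = -∑ x, ψ(x) χ(x)`. Every `χ`, the unit character included, is `0` at `0`. -/
noncomputable def gSum {F : Type*} [Field F] [Fintype F] (ψ : AddChar F ℂ) (χ : MulChar F ℂ) : ℂ :=
  -∑ x : F, ψ x * χ x

/-- The variant `g°(χ) = q ^ δ(χ) g(χ)` of the Gauss sum. -/
noncomputable def gSumO {F : Type*} [Field F] [Fintype F] (ψ : AddChar F ℂ) (χ : MulChar F ℂ) : ℂ :=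
  (Fintype.card F : ℂ) ^ charDelta χ * gSum ψ χ

/-- The Pochhammer symbol `(α)_ν = g(αν) / g(α)`. -/
noncomputable def poch {F : Type*} [Field F] [Fintype F] (ψ : AddChar F ℂ)
    (α ν : MulChar F ℂ) : ℂ :=
  gSum ψ (α * ν) / gSum ψ α

/-- The variant `(α)°_ν = g°(αν) / g°(α)` of the Pochhammer symbol. -/
noncomputable def pochO {F : Type*} [Field F] [Fintype F] (ψ : AddChar F ℂ)
    (α ν : MulChar F ℂ) : ℂ :=
  gSumO ψ (α * ν) / gSumO ψ α

/-- The parameter set `P`: the free abelian monoid over the multiplicative characters.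
The formal sum `α₁ + ⋯ + αᵣ` is the multiset `{α₁, …, αᵣ}`. -/
abbrev ParamSet (F : Type*) [Field F] : Type _ := Multiset (MulChar F ℂ)

/-- The biadditive pairing on `P` with `(α, β) = δ(α β⁻¹)` for characters `α`, `β`. -/
noncomputable def pairing {F : Type*} [Field F] (A B : ParamSet F) : ℕ :=
  (A.map fun α => (B.map fun β => charDelta (α * β⁻¹)).sum).sum

/-- `(A)_ν`: the product over the members of `A`, with multiplicity. -/
noncomputable def pochP {F : Type*} [Field F] [Fintype F] (ψ : AddChar F ℂ)
    (A : ParamSet F) (ν : MulChar F ℂ) : ℂ :=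
  (A.map fun α => poch ψ α ν).prod

/-- `(A)°_ν`: the product over the members of `A`, with multiplicity. -/
noncomputable def pochPO {F : Type*} [Field F] [Fintype F] (ψ : AddChar F ℂ)
    (A : ParamSet F) (ν : MulChar F ℂ) : ℂ :=
  (A.map fun α => pochO ψ α ν).prod

/-- The hypergeometric function
`F(A, B; x) = (1 - q)⁻¹ ∑ ν, (A)_ν / (B)°_ν * ν(x)` over the finite field `F`.
The sum is over all (finitely many) multiplicative characters `ν`. -/
noncomputable def hypF {F : Type*} [Field F] [Fintype F] (ψ : AddChar F ℂ)
    (A B : ParamSet F) (x : F) : ℂ :=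
  1 / (1 - (Fintype.card F : ℂ)) *
    ∑ᶠ ν : MulChar F ℂ, pochP ψ A ν / pochPO ψ B ν * ν x

/-- `ᵣFₛ(α₁, …, αᵣ; β₁, …, βₛ; x) = F(α₁ + ⋯ + αᵣ, ε + β₁ + ⋯ + βₛ; x)`. -/
noncomputable def rFs {F : Type*} [Field F] [Fintype F] (ψ : AddChar F ℂ)
    (A B : ParamSet F) (x : F) : ℂ :=
  hypF ψ A ({1} + B) x

/-- The quadratic character `φ`, with complex values. -/
noncomputable def quadChar (F : Type*) [Field F] [Fintype F] [DecidableEq F] : MulChar F ℂ :=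
  (quadraticChar F).ringHomComp (Int.castRingHom ℂ)

/-- In odd characteristic, `φ ^ 2 = ε` and `φ ≠ ε`. -/
theorem quadChar_spec (F : Type*) [Field F] [Fintype F] [DecidableEq F] (hp : ringChar F ≠ 2) :
    quadChar F ^ 2 = 1 ∧ quadChar F ≠ 1 := by
  refine ⟨((quadraticChar_isQuadratic F).comp _).sq_eq_one, ?_⟩
  exact (MulChar.ringHomComp_ne_one_iff (RingHom.injective_int _)).2 (quadraticChar_ne_one hp)

/-!
Write `q` for the number of elements of `F` and `g` for the Gauss sums `gSum`. By the reflection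
formula `1 / g°(χ) = χ(-1) g(χ⁻¹) / q` (`inv_gSumO`) the coefficients of every series in question
are products of Gauss sums, and such products are Mellin transforms of explicit exponential sums.
By Mellin inversion (`sum_mulMellin_inv_mul`), `₀F₁` is a Kloosterman sum
`klSum a t = ∑ y, a(y) ψ(y + t / y)`, while `₂F₀` and `₁F₁` are both given by the confluent sum
`confSum a b t = ∑ x y, a(x) b(y) ψ(x + y + t x y)`. Each product formula thus becomes an identity
for a product of two exponential sums, and four such identities suffice.

* Kummer type (`klSum_mul_klSum_neg`): in `klSum a t * klSum a (-t)` the value of `x y` is fixed by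
  orthogonality of additive characters; the sum over `x` and `y` is then one over a hyperbolic form
  and can be evaluated. This gives the product of two `₀F₁` with inverse parameters.
* Dixon type (`confSum_mul_confSum_neg`, `mulMellin_dixonSum`): the two confluent sums combine to
  `∑ x y, a(x y) b⁻¹((1 - x)(1 - y)) ψ(τ (y - x))`. Expanding `a` and `b⁻¹` in additive characters
  turns the sum over `x` and `y` again into one over a hyperbolic form, and the Mellin transform of
  the result is a Jacobi sum. This gives the product of two `₂F₀` with equal parameters, and, since
  `₁F₁` is the same confluent sum at `1 / x`, the formula for `₁F₁` with parameters
  `α; β²` and `αβ⁻²; β⁻²`.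
* Barnes type (`mulMellin_klSum_mul_klSum`): the Mellin transform of `klSum a * klSum b` is a
  Jacobi sum times Gauss sums.
* Kummer's second formula (`confSum_inv`): completing a square expresses `confSum a a⁻¹` through
  the exponential function and `klSum`. In the products considered the exponential factors cancel,
  and the two remaining formulas follow from the Barnes type identity.

Where one side involves a character `χ` and the other its square, the duplication formula
`χ(4) g(χ) g(χφ) = g(χ²) g(φ)` (`gSum_duplication`) is used. The hypotheses on the parameters
exclude the Jacobi sum `J(ε, ε)`, the only one without a uniform expression in Gauss sums
(`jacobiSum_eq_gSum`), remove the contribution of the line `x + y = 0` in the Barnes type identity,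
and make the additive expansions of the characters valid at `0`. The
factors `q ^ δ` match because `δ(χ²) = δ(χ) + δ(χφ)` (`charDelta_sq`).
-/

open AddChar MulChar

/-! ### Values of multiplicative characters -/

section Characters

variable {F : Type*} [Field F]

theorem mulChar_inv_apply (χ : MulChar F ℂ) (x : F) : χ⁻¹ x = (χ x)⁻¹ :=
  MulChar.inv_apply_eq_inv' χ x

theorem mulChar_ne_zero (χ : MulChar F ℂ) {x : F} (hx : x ≠ 0) : χ x ≠ 0 :=
  MulChar.apply_ne_zero_iff.2 (isUnit_iff_ne_zero.2 hx)

theorem mulChar_one_apply {x : F} (hx : x ≠ 0) : (1 : MulChar F ℂ) x = 1 :=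
  MulChar.one_apply (isUnit_iff_ne_zero.2 hx)

theorem mulChar_neg_one_sq (χ : MulChar F ℂ) : χ (-1) * χ (-1) = 1 := by
  rw [← map_mul]; simp

theorem mulChar_neg_one_inv (χ : MulChar F ℂ) : χ⁻¹ (-1) = χ (-1) := by
  rw [MulChar.inv_apply']; norm_num

theorem mulChar_neg (χ : MulChar F ℂ) (x : F) : χ (-x) = χ (-1) * χ x := by
  rw [← map_mul, neg_one_mul]

theorem charDelta_one : charDelta (1 : MulChar F ℂ) = 1 := by simp [charDelta]

theorem charDelta_of_ne_one {χ : MulChar F ℂ} (hχ : χ ≠ 1) : charDelta χ = 0 := by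
  simp [charDelta, hχ]

theorem charDelta_eq_zero_iff {χ : MulChar F ℂ} : charDelta χ = 0 ↔ χ ≠ 1 := by
  simp [charDelta]

theorem mulChar_sq_neg_one (χ : MulChar F ℂ) : (χ ^ 2) (-1) = 1 := by
  rw [sq, MulChar.mul_apply, mulChar_neg_one_sq]

theorem four_ne_zero_of_ringChar (hp : ringChar F ≠ 2) : (4 : F) ≠ 0 := by
  have h := Ring.two_ne_zero hp
  have h4 : (4 : F) = 2 * 2 := by norm_num
  rw [h4]
  exact mul_ne_zero h h

end Characters

/-! ### Gauss and Jacobi sums -/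

section GaussSums

variable {F : Type*} [Field F] [Fintype F] {ψ : AddChar F ℂ}

theorem gSum_eq_neg_gaussSum (χ : MulChar F ℂ) : gSum ψ χ = -gaussSum χ ψ := by
  simp [gSum, gaussSum, mul_comm]

theorem card_ne_zero_complex : (Fintype.card F : ℂ) ≠ 0 :=
  Nat.cast_ne_zero.2 Fintype.card_ne_zero

theorem one_sub_card_ne_zero : (1 - (Fintype.card F : ℂ)) ≠ 0 := by
  have h : Fintype.card F ≠ 1 := Fintype.one_lt_card.ne'
  rw [sub_ne_zero]
  exact_mod_cast h.symm

theorem one_div_one_sub_card_mul (c z : ℂ) :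
    1 / (1 - (Fintype.card F : ℂ)) * (c * (((Fintype.card F : ℂ) - 1) * z)) = -(c * z) := by
  have hq := one_sub_card_ne_zero (F := F)
  field_simp
  ring

theorem poch_def (α ν : MulChar F ℂ) : poch ψ α ν = gSum ψ (α * ν) / gSum ψ α := rfl

theorem gSum_one (hψ : ψ ≠ 1) : gSum ψ 1 = 1 := by
  rw [gSum_eq_neg_gaussSum, gaussSum_one_left hψ, neg_neg]

theorem gSumO_one (hψ : ψ ≠ 1) : gSumO ψ 1 = Fintype.card F := by
  simp [gSumO, charDelta, gSum_one hψ]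

theorem gSumO_of_ne_one {χ : MulChar F ℂ} (hχ : χ ≠ 1) : gSumO ψ χ = gSum ψ χ := by
  simp [gSumO, charDelta, hχ]

theorem sum_addChar_mul [DecidableEq F] (hψ : ψ ≠ 1) (c : F) :
    ∑ x, ψ (c * x) = if c = 0 then (Fintype.card F : ℂ) else 0 := by
  simp_rw [mul_comm c]
  exact_mod_cast sum_mulShift c (IsPrimitive.of_ne_one hψ)

theorem sum_addChar_mul_of_ne_zero (hψ : ψ ≠ 1) {c : F} (hc : c ≠ 0) : ∑ x, ψ (c * x) = 0 := by
  classical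
  rw [sum_addChar_mul hψ, if_neg hc]

/-- The substitution `x ↦ c x` in a Gauss sum. For `χ ≠ 1` it remains valid at `c = 0`, where both
sides vanish. -/
theorem sum_mulChar_mul_addChar (χ : MulChar F ℂ) {c : F} (h : χ ≠ 1 ∨ c ≠ 0) :
    ∑ x, χ x * ψ (c * x) = -(χ⁻¹ c * gSum ψ χ) := by
  by_cases hc : c = 0
  · subst hc
    have hχ : χ ≠ 1 := h.resolve_right (by simp)
    simp [MulChar.sum_eq_zero_of_ne_one hχ]
  · have := gaussSum_mulShift_eq χ ψ (Units.mk0 c hc)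
    simp only [gaussSum, mulShift_apply, Units.val_mk0] at this
    rw [this, gSum_eq_neg_gaussSum, gaussSum]
    ring

/-- Reflection, valid for `χ = 1` as well because of the factor `q` in `g°(1)`. -/
theorem gSum_inv_mul_gSumO (hψ : ψ ≠ 1) (χ : MulChar F ℂ) :
    gSum ψ χ⁻¹ * gSumO ψ χ = χ (-1) * Fintype.card F := by
  by_cases hχ : χ = 1
  · subst hχ
    rw [inv_one, gSum_one hψ, gSumO_one hψ, MulChar.one_apply (by simp)]
  · rw [gSumO_of_ne_one hχ, gSum_eq_neg_gaussSum, gSum_eq_neg_gaussSum, neg_mul_neg,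
      ← mul_gaussSum_inv_eq_gaussSum χ⁻¹, mulChar_neg_one_inv, mul_assoc, mul_comm (gaussSum _ _),
      gaussSum_mul_gaussSum_eq_card hχ (IsPrimitive.of_ne_one hψ)]

theorem gSumO_ne_zero (hψ : ψ ≠ 1) (χ : MulChar F ℂ) : gSumO ψ χ ≠ 0 := by
  refine right_ne_zero_of_mul (a := gSum ψ χ⁻¹) ?_
  rw [gSum_inv_mul_gSumO hψ]
  exact mul_ne_zero (mulChar_ne_zero χ (by simp)) card_ne_zero_complex

theorem gSum_ne_zero (hψ : ψ ≠ 1) (χ : MulChar F ℂ) : gSum ψ χ ≠ 0 := by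
  refine right_ne_zero_of_mul (a := (Fintype.card F : ℂ) ^ charDelta χ) ?_
  exact gSumO_ne_zero hψ χ

/-- Reflection: the reciprocal of `g°(χ)` is a Gauss sum of `χ⁻¹`, for every `χ`. -/
theorem inv_gSumO (hψ : ψ ≠ 1) (χ : MulChar F ℂ) :
    (gSumO ψ χ)⁻¹ = χ (-1) * gSum ψ χ⁻¹ / Fintype.card F := by
  refine inv_eq_of_mul_eq_one_left ?_
  rw [div_mul_eq_mul_div, mul_assoc, gSum_inv_mul_gSumO hψ, ← mul_assoc, mulChar_neg_one_sq,
    one_mul, div_self card_ne_zero_complex]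

theorem gSum_mul_gSum_inv (hψ : ψ ≠ 1) {χ : MulChar F ℂ} (hχ : χ ≠ 1) :
    gSum ψ χ * gSum ψ χ⁻¹ = χ (-1) * Fintype.card F := by
  rw [← gSum_inv_mul_gSumO hψ, gSumO_of_ne_one hχ, mul_comm]

theorem gSumO_mul_gSumO_inv (hψ : ψ ≠ 1) (χ : MulChar F ℂ) :
    gSumO ψ χ * gSumO ψ χ⁻¹ = χ (-1) * Fintype.card F * (Fintype.card F : ℂ) ^ charDelta χ := by
  rw [← gSum_inv_mul_gSumO hψ, gSumO, gSumO, charDelta, charDelta]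
  simp only [inv_eq_one]
  ring_nf

/-- Jacobi sums in terms of Gauss sums. With `g°` in the denominator the formula also covers
`χ χ' = 1`, as long as `χ` and `χ'` are not both trivial. -/
theorem jacobiSum_eq_gSum (hψ : ψ ≠ 1) {χ χ' : MulChar F ℂ} (h : ¬(χ = 1 ∧ χ' = 1)) :
    jacobiSum χ χ' = -(gSum ψ χ * gSum ψ χ' / gSumO ψ (χ * χ')) := by
  rw [← neg_div, eq_div_iff (gSumO_ne_zero hψ _)]
  by_cases hm : χ * χ' = 1
  · have h1 : χ ≠ 1 := fun h1 => h ⟨h1, by simpa [h1] using hm⟩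
    obtain rfl : χ' = χ⁻¹ := (inv_eq_of_mul_eq_one_right hm).symm
    rw [jacobiSum_nontrivial_inv h1, hm, gSumO_one hψ, gSum_mul_gSum_inv hψ h1, neg_mul]
  · rw [gSumO_of_ne_one hm, gSum_eq_neg_gaussSum, gSum_eq_neg_gaussSum, gSum_eq_neg_gaussSum,
      neg_mul_neg, ← jacobiSum_mul_nontrivial hm]
    ring

theorem jacobiSum_eq_gSum_inv (hψ : ψ ≠ 1) {χ χ' : MulChar F ℂ} (h : ¬(χ = 1 ∧ χ' = 1)) :
    jacobiSum χ χ' = -((χ * χ') (-1) * gSum ψ χ * gSum ψ χ' * gSum ψ (χ * χ')⁻¹ /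
      Fintype.card F) := by
  rw [jacobiSum_eq_gSum hψ h, div_eq_mul_inv _ (gSumO ψ _), inv_gSumO hψ]
  ring

/-! ### The quadratic character and the duplication formula -/

section Quadratic

variable [DecidableEq F]

theorem quadChar_mul_self (hp : ringChar F ≠ 2) : quadChar F * quadChar F = 1 := by
  rw [← sq, (quadChar_spec F hp).1]

theorem quadChar_inv (hp : ringChar F ≠ 2) : (quadChar F)⁻¹ = quadChar F :=
  inv_eq_of_mul_eq_one_right (quadChar_mul_self hp)

theorem quadChar_ne_one (hp : ringChar F ≠ 2) : quadChar F ≠ 1 := (quadChar_spec F hp).2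

theorem quadChar_apply_mul_self (hp : ringChar F ≠ 2) {x : F} (hx : x ≠ 0) :
    quadChar F x * quadChar F x = 1 := by
  rw [← MulChar.mul_apply, quadChar_mul_self hp, MulChar.one_apply (isUnit_iff_ne_zero.2 hx)]

theorem gSum_quadChar_sq (hp : ringChar F ≠ 2) (hψ : ψ ≠ 1) :
    gSum ψ (quadChar F) * gSum ψ (quadChar F) = quadChar F (-1) * Fintype.card F := by
  have := gSum_mul_gSum_inv hψ (quadChar_ne_one hp)
  rwa [quadChar_inv hp] at this

/-- Summation over squares: a square root of `s` exists `1 + φ(s)` times. -/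
theorem sum_comp_sq (hp : ringChar F ≠ 2) (f : F → ℂ) :
    ∑ x : F, f (x ^ 2) = ∑ s : F, (1 + quadChar F s) * f s := by
  rw [← Finset.sum_fiberwise' Finset.univ (fun x : F => x ^ 2) f]
  refine Finset.sum_congr rfl fun s _ => ?_
  have h := quadraticChar_card_sqrts hp s
  rw [Finset.sum_const, nsmul_eq_mul]
  congr 1
  have h' : (((Finset.univ.filter fun x : F => x ^ 2 = s).card : ℤ) : ℂ) =
      ((quadraticChar F s + 1 : ℤ) : ℂ) := by
    rw [← h]
    congr 3
    ext x
    simp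
  rw [Int.cast_natCast] at h'
  rw [h', quadChar, ringHomComp_apply]
  push_cast
  simp [add_comm]

/-- The only non-trivial character of order `2` is `φ`: otherwise `∑ χ(x²)` would be both
`q - 1` and `0`. -/
theorem eq_quadChar_of_sq_eq_one (hp : ringChar F ≠ 2) {χ : MulChar F ℂ} (h : χ ^ 2 = 1)
    (hχ : χ ≠ 1) : χ = quadChar F := by
  by_contra hne
  have hne' : quadChar F * χ ≠ 1 := fun h' =>
    hne (by rw [eq_inv_of_mul_eq_one_right h', quadChar_inv hp])
  have h1 := sum_comp_sq hp χ
  simp_rw [add_mul, one_mul, ← MulChar.mul_apply] at h1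
  rw [Finset.sum_add_distrib, MulChar.sum_eq_zero_of_ne_one hχ,
    MulChar.sum_eq_zero_of_ne_one hne', add_zero] at h1
  simp_rw [map_pow, ← MulChar.pow_apply' χ two_ne_zero, h] at h1
  rw [MulChar.sum_one_eq_card_units] at h1
  exact Fintype.card_ne_zero (Nat.cast_eq_zero.1 h1)

/-- A character with trivial square is trivial or equal to `φ`, and not both. -/
theorem charDelta_sq (hp : ringChar F ≠ 2) (χ : MulChar F ℂ) :
    charDelta (χ ^ 2) = charDelta χ + charDelta (χ * quadChar F) := by
  by_cases h1 : χ = 1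
  · subst h1
    rw [one_pow, charDelta_one, one_mul, charDelta_of_ne_one (quadChar_ne_one hp)]
  by_cases h2 : χ = quadChar F
  · subst h2
    rw [sq, quadChar_mul_self hp, charDelta_one, charDelta_of_ne_one (quadChar_ne_one hp)]
  rw [charDelta_of_ne_one h1, charDelta_of_ne_one fun h => h2 (eq_quadChar_of_sq_eq_one hp h h1),
    charDelta_of_ne_one fun h => h2 (by rw [mul_eq_one_iff_eq_inv.1 h, quadChar_inv hp])]

/-- The quadratic Gauss sum. -/
theorem sum_addChar_sq (hp : ringChar F ≠ 2) (hψ : ψ ≠ 1) {m : F} (hm : m ≠ 0) :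
    ∑ x, ψ (m * x ^ 2) = -(quadChar F m * gSum ψ (quadChar F)) := by
  rw [sum_comp_sq hp (fun s => ψ (m * s))]
  simp_rw [add_mul, one_mul]
  rw [Finset.sum_add_distrib, sum_addChar_mul_of_ne_zero hψ hm, zero_add,
    sum_mulChar_mul_addChar _ (Or.inr hm), quadChar_inv hp]

/-- The duplication formula `χ(4) g(χ) g(χφ) = g(χ²) g(φ)` of Hasse and Davenport. It follows from
`J(χ, χ) = χ(4)⁻¹ J(χ, φ)`, obtained by writing `x (1 - x) = (1 - z²) / 4`. -/
theorem gSum_duplication (hp : ringChar F ≠ 2) (hψ : ψ ≠ 1) (χ : MulChar F ℂ) :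
    χ 4 * (gSum ψ χ * gSum ψ (χ * quadChar F)) = gSum ψ (χ ^ 2) * gSum ψ (quadChar F) := by
  have h4 := four_ne_zero_of_ringChar hp
  have h2 := Ring.two_ne_zero hp
  by_cases hχ : χ = 1
  · subst hχ
    rw [MulChar.one_apply (isUnit_iff_ne_zero.2 h4)]
    simp
  have hJ : χ 4 * jacobiSum χ χ = jacobiSum χ (quadChar F) := by
    -- `x = (z + 1) / 2` turns `x (1 - x)` into `(1 - z²) / 4`.
    have e : jacobiSum χ χ = ∑ z : F, χ⁻¹ 4 * χ (1 - z ^ 2) := by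
      rw [jacobiSum, ← Equiv.sum_comp ((Equiv.mulRight₀ (2⁻¹ : F) (inv_ne_zero h2)).trans
        (Equiv.addRight (2⁻¹ : F)))]
      refine Finset.sum_congr rfl fun z _ => ?_
      rw [MulChar.inv_apply', ← map_mul, ← map_mul]
      congr 1
      simp only [Equiv.trans_apply, Equiv.mulRight₀_apply, Equiv.coe_addRight]
      have h42 : (4 : F) = 2 * 2 := by norm_num
      rw [h42]
      field_simp
      ring_nf
    rw [e, ← Finset.mul_sum, sum_comp_sq hp (fun s => χ (1 - s)), mulChar_inv_apply,
      mul_inv_cancel_left₀ (mulChar_ne_zero χ h4), jacobiSum_comm, jacobiSum]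
    simp_rw [add_mul, one_mul]
    rw [Finset.sum_add_distrib,
      show ∑ x, χ (1 - x) = _ from Equiv.sum_comp (Equiv.subLeft (1 : F)) χ,
      MulChar.sum_eq_zero_of_ne_one hχ, zero_add]
  rw [jacobiSum_eq_gSum hψ (fun h => hχ h.1), jacobiSum_eq_gSum hψ (fun h => hχ h.1), ← sq χ] at hJ
  have hg := gSum_ne_zero hψ χ
  by_cases h3 : χ * quadChar F = 1
  · obtain rfl : χ = quadChar F := by
      rw [mul_eq_one_iff_eq_inv.1 h3, quadChar_inv hp]
    rw [h3, gSum_one hψ, sq, h3, gSum_one hψ]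
    have : (quadChar F) 4 = 1 := by
      have h42 : (4 : F) = 2 * 2 := by norm_num
      rw [h42, map_mul, quadChar_apply_mul_self hp h2]
    rw [this]
    ring
  · have h4 : χ ^ 2 ≠ 1 := fun h => h3 (by
      rw [eq_quadChar_of_sq_eq_one hp h hχ, quadChar_mul_self hp])
    rw [gSumO_of_ne_one h3, gSumO_of_ne_one h4] at hJ
    have h5 := gSum_ne_zero hψ (χ ^ 2)
    have h6 := gSum_ne_zero hψ (χ * quadChar F)
    field_simp at hJ
    linear_combination -hJ

end Quadratic

end GaussSums

/-! ### Mellin transforms and series as exponential sums -/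

section Mellin

variable {F : Type*} [Field F] [Fintype F] {ψ : AddChar F ℂ}

/-- Turns the `finsum` in `hypF` into a `Finset` sum. -/
noncomputable instance fintypeMulChar (F : Type*) [Field F] [Fintype F] :
    Fintype (MulChar F ℂ) := Fintype.ofFinite _

theorem sum_mulChar_apply [DecidableEq F] (x : F) :
    ∑ ν : MulChar F ℂ, ν x = if x = 1 then (Fintype.card F : ℂ) - 1 else 0 := by
  by_cases hx : x = 1
  · subst hx
    have h := MulChar.card_eq_card_units_of_hasEnoughRootsOfUnity F ℂ
    rw [Nat.card_eq_fintype_card, Nat.card_eq_fintype_card, Fintype.card_units] at h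
    simp only [map_one, Finset.sum_const, Finset.card_univ, h, if_true, nsmul_eq_mul, mul_one]
    rw [Nat.cast_sub Fintype.card_pos, Nat.cast_one]
  · rw [if_neg hx]
    obtain ⟨χ, hχ⟩ := MulChar.exists_apply_ne_one_of_hasEnoughRootsOfUnity F ℂ hx
    have h := Equiv.sum_comp (Equiv.mulLeft χ) (fun ν : MulChar F ℂ => ν x)
    simp only [Equiv.coe_mulLeft, MulChar.mul_apply, ← Finset.mul_sum] at h
    have h' : (χ x - 1) * ∑ ν : MulChar F ℂ, ν x = 0 := by linear_combination h
    exact (mul_eq_zero.1 h').resolve_left (sub_ne_zero.2 hχ)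

/-- The Mellin transform `ν ↦ ∑ x, ν(x) f(x)` of a function on `F`; it ignores the value `f 0`. -/
noncomputable def mulMellin (f : F → ℂ) (ν : MulChar F ℂ) : ℂ := ∑ x, ν x * f x

/-- Mellin inversion. -/
theorem sum_mulMellin_inv_mul (f : F → ℂ) {t : F} (ht : t ≠ 0) :
    ∑ ν : MulChar F ℂ, mulMellin f ν⁻¹ * ν t = ((Fintype.card F : ℂ) - 1) * f t := by
  classical
  simp_rw [mulMellin, Finset.sum_mul]
  rw [Finset.sum_comm]
  have h : ∀ x : F, ∑ ν : MulChar F ℂ, ν⁻¹ x * f x * ν t =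
      (if x = t then (Fintype.card F : ℂ) - 1 else 0) * f x := by
    intro x
    by_cases hx : x = 0
    · subst hx
      rw [if_neg ht.symm, zero_mul]
      exact Finset.sum_eq_zero fun ν _ => by rw [MulChar.map_zero, zero_mul, zero_mul]
    have hxt : (x⁻¹ * t = 1) ↔ x = t := by
      rw [inv_mul_eq_one₀ hx]
    simp_rw [← hxt]
    rw [← sum_mulChar_apply, Finset.sum_mul]
    refine Finset.sum_congr rfl fun ν _ => ?_
    rw [MulChar.inv_apply', map_mul]
    ring
  simp_rw [h, ite_mul, zero_mul, Finset.sum_ite_eq', Finset.mem_univ, if_true]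

/-- The Kloosterman sum `∑ y, a(y) ψ(y + t / y)`. -/
noncomputable def klSum (ψ : AddChar F ℂ) (a : MulChar F ℂ) (t : F) : ℂ :=
  ∑ y, a y * ψ (y + t / y)

/-- The confluent sum `∑ x y, a(x) b(y) ψ(x + y + t x y)`. -/
noncomputable def confSum (ψ : AddChar F ℂ) (a b : MulChar F ℂ) (t : F) : ℂ :=
  ∑ x, ∑ y, a x * b y * ψ (x + y + t * (x * y))

theorem mellin_klSum (a ν : MulChar F ℂ) :
    mulMellin (klSum ψ a) ν = gSum ψ ν * gSum ψ (a * ν) := by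
  simp_rw [mulMellin, klSum, Finset.mul_sum]
  rw [Finset.sum_comm]
  have h : ∀ y : F, ∑ t, ν t * (a y * ψ (y + t / y)) = -gSum ψ ν * (ψ y * (a * ν) y) := by
    intro y
    by_cases hy : y = 0
    · simp [hy]
    calc ∑ t, ν t * (a y * ψ (y + t / y))
        = a y * ψ y * ∑ t, ν t * ψ (y⁻¹ * t) := by
          rw [Finset.mul_sum]
          refine Finset.sum_congr rfl fun t _ => ?_
          rw [AddChar.map_add_eq_mul, div_eq_inv_mul]
          ring
      _ = _ := by
          rw [sum_mulChar_mul_addChar ν (Or.inr (inv_ne_zero hy)), MulChar.inv_apply', inv_inv,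
            MulChar.mul_apply]
          ring
  simp_rw [h]
  rw [← Finset.mul_sum, gSum, gSum]
  ring

theorem mellin_confSum (a b ν : MulChar F ℂ) :
    mulMellin (confSum ψ a b) ν = -(gSum ψ ν * gSum ψ (a * ν⁻¹) * gSum ψ (b * ν⁻¹)) := by
  simp_rw [mulMellin, confSum, Finset.mul_sum]
  rw [Finset.sum_comm]
  have h : ∀ x y : F, ∑ t, ν t * (a x * b y * ψ (x + y + t * (x * y))) =
      -gSum ψ ν * ((ψ x * (a * ν⁻¹) x) * (ψ y * (b * ν⁻¹) y)) := by
    intro x y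
    by_cases hx : x = 0
    · simp [hx]
    by_cases hy : y = 0
    · simp [hy]
    calc ∑ t, ν t * (a x * b y * ψ (x + y + t * (x * y)))
        = a x * b y * (ψ x * ψ y) * ∑ t, ν t * ψ (x * y * t) := by
          rw [Finset.mul_sum]
          refine Finset.sum_congr rfl fun t _ => ?_
          rw [AddChar.map_add_eq_mul, AddChar.map_add_eq_mul, mul_comm t]
          ring
      _ = _ := by
          rw [sum_mulChar_mul_addChar ν (Or.inr (mul_ne_zero hx hy)), map_mul, MulChar.mul_apply,
            MulChar.mul_apply]
          ring
  have h' : ∀ x : F, ∑ t, ∑ y, ν t * (a x * b y * ψ (x + y + t * (x * y))) =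
      ∑ y, -gSum ψ ν * ((ψ x * (a * ν⁻¹) x) * (ψ y * (b * ν⁻¹) y)) := fun x => by
    rw [Finset.sum_comm]
    exact Finset.sum_congr rfl fun y _ => h x y
  simp_rw [h', ← Finset.mul_sum, ← Finset.sum_mul]
  rw [gSum, gSum, gSum]
  ring

theorem confSum_comm (a b : MulChar F ℂ) (t : F) : confSum ψ a b t = confSum ψ b a t := by
  rw [confSum, Finset.sum_comm, confSum]
  refine Finset.sum_congr rfl fun x _ => Finset.sum_congr rfl fun y _ => ?_
  rw [mul_comm (a y), add_comm y, mul_comm y]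

theorem hypF_eq_sum (A B : ParamSet F) (x : F) :
    hypF ψ A B x = 1 / (1 - (Fintype.card F : ℂ)) *
      ∑ ν : MulChar F ℂ, pochP ψ A ν / pochPO ψ B ν * ν x := by
  rw [hypF, finsum_eq_sum_of_fintype]

theorem rFs_zero (A B : ParamSet F) : rFs ψ A B 0 = 0 := by
  simp [rFs, hypF_eq_sum]

/-- The reciprocal of `(χ)°_ν`, by reflection. -/
theorem inv_pochO (hψ : ψ ≠ 1) (χ ν : MulChar F ℂ) :
    (pochO ψ χ ν)⁻¹ = gSumO ψ χ * (χ (-1) * ν (-1) * gSum ψ (χ⁻¹ * ν⁻¹)) / Fintype.card F := by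
  rw [pochO, inv_div, div_eq_mul_inv, inv_gSumO hψ, MulChar.mul_apply, mul_inv]
  ring

theorem inv_pochO_one (hψ : ψ ≠ 1) (ν : MulChar F ℂ) :
    (pochO ψ 1 ν)⁻¹ = ν (-1) * gSum ψ ν⁻¹ := by
  have := card_ne_zero_complex (F := F)
  rw [inv_pochO hψ, gSumO_one hψ, inv_one, one_mul, MulChar.one_apply (by simp)]
  field_simp

/-- `₀F₁(b; x)` is a Kloosterman sum. -/
theorem rFs_zero_one (hψ : ψ ≠ 1) (b : MulChar F ℂ) {x : F} (hx : x ≠ 0) :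
    rFs ψ 0 {b} x = -(gSumO ψ b * b (-1) / Fintype.card F * klSum ψ b⁻¹ x) := by
  have key := sum_mulMellin_inv_mul (klSum ψ b⁻¹) hx
  have e : ∀ ν : MulChar F ℂ, pochP ψ 0 ν / pochPO ψ ({1} + {b}) ν * ν x =
      gSumO ψ b * b (-1) / Fintype.card F * (mulMellin (klSum ψ b⁻¹) ν⁻¹ * ν x) := by
    intro ν
    have hs := mulChar_neg_one_sq ν
    simp only [pochP, pochPO, Multiset.map_zero, Multiset.prod_zero, Multiset.map_add,
      Multiset.map_singleton, Multiset.prod_add, Multiset.prod_singleton, one_div, mul_inv]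
    rw [inv_pochO_one hψ, inv_pochO hψ, mellin_klSum]
    linear_combination (gSum ψ ν⁻¹ * gSumO ψ b * b (-1) * gSum ψ (b⁻¹ * ν⁻¹) /
      Fintype.card F * ν x) * hs
  rw [rFs, hypF_eq_sum]
  simp_rw [e]
  rw [← Finset.mul_sum, key, one_div_one_sub_card_mul]

/-- `₂F₀(a, b; x)` is a confluent sum. -/
theorem rFs_two_zero (hψ : ψ ≠ 1) (a b : MulChar F ℂ) {x : F} (hx : x ≠ 0) :
    rFs ψ {a, b} 0 x = confSum ψ a b (-x) / (gSum ψ a * gSum ψ b) := by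
  have key := sum_mulMellin_inv_mul (confSum ψ a b) (neg_ne_zero.2 hx)
  have e : ∀ ν : MulChar F ℂ, pochP ψ {a, b} ν / pochPO ψ ({1} + 0) ν * ν x =
      -(1 / (gSum ψ a * gSum ψ b)) * (mulMellin (confSum ψ a b) ν⁻¹ * ν (-x)) := by
    intro ν
    simp only [pochP, pochPO, add_zero, Multiset.insert_eq_cons, Multiset.map_cons,
      Multiset.prod_cons, Multiset.map_singleton, Multiset.prod_singleton]
    rw [div_eq_mul_inv _ (pochO ψ 1 ν), inv_pochO_one hψ, mellin_confSum, mulChar_neg ν x, inv_inv,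
      poch, poch]
    field_simp
  rw [rFs, hypF_eq_sum]
  simp_rw [e]
  rw [← Finset.mul_sum, key, one_div_one_sub_card_mul]
  ring

/-- `₁F₁(a; b; x)` is a confluent sum at `1 / x`: substitute `ν ↦ (a ν)⁻¹` in the series. -/
theorem rFs_one_one (hψ : ψ ≠ 1) (a b : MulChar F ℂ) {x : F} (hx : x ≠ 0) :
    rFs ψ {a} {b} x = gSumO ψ b * b (-1) / (Fintype.card F * gSum ψ a) *
      (a x)⁻¹ * confSum ψ a (a * b⁻¹) x⁻¹ := by
  have key := sum_mulMellin_inv_mul (confSum ψ a (a * b⁻¹)) (inv_ne_zero hx)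
  have e : ∀ ν : MulChar F ℂ,
      pochP ψ {a} (a⁻¹ * ν⁻¹) / pochPO ψ ({1} + {b}) (a⁻¹ * ν⁻¹) * (a⁻¹ * ν⁻¹) x =
      -(gSumO ψ b * b (-1) / (Fintype.card F * gSum ψ a) * (a x)⁻¹) *
        (mulMellin (confSum ψ a (a * b⁻¹)) ν⁻¹ * ν x⁻¹) := by
    intro ν
    have hs := mulChar_neg_one_sq (a⁻¹ * ν⁻¹)
    simp only [pochP, pochPO, Multiset.map_add,
      Multiset.map_singleton, Multiset.prod_add, Multiset.prod_singleton]
    have e1 : a * (a⁻¹ * ν⁻¹) = ν⁻¹ := mul_inv_cancel_left a _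
    have e2 : (a⁻¹ * ν⁻¹)⁻¹ = a * ν := by rw [mul_inv, inv_inv, inv_inv]
    have e3 : b⁻¹ * (a * ν) = a * b⁻¹ * ν := by rw [mul_left_comm, mul_assoc]
    rw [div_eq_mul_inv _ (_ * _), mul_inv, inv_pochO_one hψ, inv_pochO hψ, mellin_confSum, inv_inv,
      poch, e1, e2, e3, ← MulChar.inv_apply', MulChar.mul_apply _ _ x, mulChar_inv_apply a x]
    linear_combination (gSum ψ ν⁻¹ / gSum ψ a * gSum ψ (a * ν) * gSumO ψ b * b (-1) *
      gSum ψ (a * b⁻¹ * ν) / Fintype.card F * ((a x)⁻¹ * ν⁻¹ x)) * hs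
  rw [rFs, hypF_eq_sum, ← Equiv.sum_comp ((Equiv.inv _).trans (Equiv.mulLeft a⁻¹))]
  simp only [Equiv.trans_apply, Equiv.inv_apply, Equiv.coe_mulLeft]
  simp_rw [e]
  rw [← Finset.mul_sum, key, one_div_one_sub_card_mul]
  ring

end Mellin

/-! ### Products of exponential sums -/

section ProductIdentities

variable {F : Type*} [Field F] [Fintype F] {ψ : AddChar F ℂ}

/-- An exponential sum over the hyperbolic form `k x y`, with linear terms. -/
theorem sum_sum_addChar_hyperbolic (hψ : ψ ≠ 1) {k α β : F} (h : k = 0 → α ≠ 0 ∨ β ≠ 0) :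
    ∑ x, ∑ y, ψ (k * (x * y) + α * x + β * y) =
      Fintype.card F * ((1 : MulChar F ℂ) k * ψ (-(α * β / k))) := by
  classical
  have e : ∀ x : F, ∑ y, ψ (k * (x * y) + α * x + β * y) =
      ψ (α * x) * if k * x + β = 0 then (Fintype.card F : ℂ) else 0 := by
    intro x
    rw [← sum_addChar_mul hψ, Finset.mul_sum]
    refine Finset.sum_congr rfl fun y _ => ?_
    rw [← AddChar.map_add_eq_mul]
    congr 1
    ring
  simp_rw [e]
  by_cases hk : k = 0
  · subst hk
    rw [MulChar.map_zero, zero_mul, mul_zero]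
    by_cases hβ : β = 0
    · have hα := (h rfl).resolve_right (not_not.2 hβ)
      simp [hβ, ← Finset.sum_mul, sum_addChar_mul_of_ne_zero hψ hα]
    · simp [hβ]
  · have e2 : ∀ x : F, (k * x + β = 0) ↔ x = -(β / k) := by
      intro x
      constructor
      · intro h'
        field_simp
        linear_combination h'
      · rintro rfl
        field_simp
        ring
    simp_rw [e2, mul_ite, mul_zero, Finset.sum_ite_eq', Finset.mem_univ, if_true,
      mulChar_one_apply hk, one_mul, mul_comm _ (Fintype.card F : ℂ)]
    congr 2
    ring

/-- Coordinates `x = s u`, `y = s (1 - u)` on the plane away from the line `x + y = 0`. -/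
theorem sum_sum_eq_sum_sum_mul_one_sub (f : F → F → ℂ) (hf : ∀ x, f x (-x) = 0) :
    ∑ x, ∑ y, f x y = ∑ s, ∑ u, (1 : MulChar F ℂ) s * f (s * u) (s * (1 - u)) := by
  have e : ∑ x, ∑ y, f x y = ∑ x, ∑ s, f x (s - x) :=
    Finset.sum_congr rfl fun x _ => (Equiv.sum_comp (Equiv.subRight x) (f x)).symm
  rw [e, Finset.sum_comm]
  refine Finset.sum_congr rfl fun s _ => ?_
  by_cases hs : s = 0
  · subst hs
    simp [hf]
  · rw [← Equiv.sum_comp (Equiv.mulLeft₀ s hs)]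
    refine Finset.sum_congr rfl fun u _ => ?_
    rw [mulChar_one_apply hs, one_mul, Equiv.mulLeft₀_apply, mul_one_sub]

/-- The threefold Kloosterman-type sum to which `klSum a t * klSum a (-t)` reduces. -/
noncomputable def kummerSum (ψ : AddChar F ℂ) (a : MulChar F ℂ) (u : F) : ℂ :=
  ∑ n, ∑ r, a (r * n) * ψ (n + r + u / (r ^ 2 * n))

theorem mulMellin_kummerSum (a ν : MulChar F ℂ) :
    mulMellin (kummerSum ψ a) ν = -(gSum ψ ν * gSum ψ (a * ν) * gSum ψ (a * ν ^ 2)) := by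
  simp_rw [mulMellin, kummerSum, Finset.mul_sum]
  rw [Finset.sum_comm]
  have h : ∀ n r : F, ∑ u, ν u * (a (r * n) * ψ (n + r + u / (r ^ 2 * n))) =
      -gSum ψ ν * ((ψ n * (a * ν) n) * (ψ r * (a * ν ^ 2) r)) := by
    intro n r
    by_cases hn : n = 0
    · simp [hn]
    by_cases hr : r = 0
    · simp [hr]
    have hrn : r ^ 2 * n ≠ 0 := mul_ne_zero (pow_ne_zero 2 hr) hn
    calc ∑ u, ν u * (a (r * n) * ψ (n + r + u / (r ^ 2 * n)))
        = a (r * n) * (ψ n * ψ r) * ∑ u, ν u * ψ ((r ^ 2 * n)⁻¹ * u) := by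
          rw [Finset.mul_sum]
          refine Finset.sum_congr rfl fun t _ => ?_
          rw [AddChar.map_add_eq_mul, AddChar.map_add_eq_mul, div_eq_inv_mul]
          ring
      _ = _ := by
          rw [sum_mulChar_mul_addChar ν (Or.inr (inv_ne_zero hrn)), MulChar.inv_apply', inv_inv,
            MulChar.mul_apply, MulChar.mul_apply, MulChar.pow_apply' _ two_ne_zero, map_mul,
            map_mul, map_pow]
          ring
  have h' : ∀ n : F, ∑ u, ∑ r, ν u * (a (r * n) * ψ (n + r + u / (r ^ 2 * n))) =
      ∑ r, -gSum ψ ν * ((ψ n * (a * ν) n) * (ψ r * (a * ν ^ 2) r)) := fun n => by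
    rw [Finset.sum_comm]
    exact Finset.sum_congr rfl fun r _ => h n r
  simp_rw [h', ← Finset.mul_sum, ← Finset.sum_mul]
  rw [gSum, gSum, gSum]
  ring

/-- Kummer-type product. The relation `x y = r` is detected by additive characters, after which
`x` and `y` are summed over a hyperbolic form. -/
theorem klSum_mul_klSum_neg (hp : ringChar F ≠ 2) (hψ : ψ ≠ 1) (a : MulChar F ℂ) (t : F) :
    klSum ψ a t * klSum ψ a (-t) = kummerSum ψ a (-t ^ 2) := by
  classical
  have hc := card_ne_zero_complex (F := F)
  have h2 := Ring.two_ne_zero hp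
  refine mul_left_cancel₀ hc ?_
  -- The sum over `n` detects `r = x y`, where `t / x - t / y = t (y - x) / r`.
  have e1 : ∀ x y : F, Fintype.card F * (a x * ψ (x + t / x) * (a y * ψ (y + -t / y))) =
      ∑ r, ∑ n, a r * ψ (n * (x * y) + (1 - t / r) * x + (1 + t / r) * y) * ψ (-(n * r)) := by
    intro x y
    have e : ∀ r : F,
        ∑ n, a r * ψ (n * (x * y) + (1 - t / r) * x + (1 + t / r) * y) * ψ (-(n * r)) =
          if r = x * y then
            Fintype.card F * (a r * ψ ((1 - t / r) * x + (1 + t / r) * y)) else 0 := by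
      intro r
      have h := sum_addChar_mul hψ (x * y - r)
      simp_rw [sub_eq_zero, eq_comm (a := x * y)] at h
      rw [mul_comm (Fintype.card F : ℂ), ← mul_zero (a r * ψ ((1 - t / r) * x + (1 + t / r) * y)),
        ← mul_ite, ← h, Finset.mul_sum]
      refine Finset.sum_congr rfl fun n _ => ?_
      rw [mul_assoc, mul_assoc, ← AddChar.map_add_eq_mul, ← AddChar.map_add_eq_mul]
      congr 2
      ring
    simp_rw [e, Finset.sum_ite_eq', Finset.mem_univ, if_true]
    by_cases hx : x = 0
    · simp [hx]
    by_cases hy : y = 0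
    · simp [hy]
    rw [mul_mul_mul_comm, ← map_mul, ← AddChar.map_add_eq_mul]
    congr 3
    field_simp
    ring
  -- Both linear coefficients cannot vanish at once, since their sum is `2`.
  have e2 : ∀ r n : F,
      ∑ x, ∑ y, a r * ψ (n * (x * y) + (1 - t / r) * x + (1 + t / r) * y) * ψ (-(n * r)) =
        Fintype.card F *
          (a r * (1 : MulChar F ℂ) n * ψ (-((1 - t / r) * (1 + t / r) / n) - n * r)) := by
    intro r n
    by_cases hr : r = 0
    · simp [hr]
    simp_rw [← Finset.sum_mul, ← Finset.mul_sum]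
    rw [sum_sum_addChar_hyperbolic hψ, sub_eq_add_neg _ (n * r), AddChar.map_add_eq_mul]
    · ring
    · intro _
      by_contra! h
      refine h2 ?_
      linear_combination h.1 + h.2
  -- The substitution `n ↦ -1 / n`.
  have e3 : ∀ r : F, ∑ n, a r * (1 : MulChar F ℂ) n *
      ψ (-((1 - t / r) * (1 + t / r) / n) - n * r) =
        ∑ n, (1 : MulChar F ℂ) n * (a r * ψ (n + r / n + -t ^ 2 * n / r ^ 2)) := by
    intro r
    by_cases hr : r = 0
    · simp [hr]
    rw [← Equiv.sum_comp ((Equiv.inv F).trans (Equiv.neg F))]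
    refine Finset.sum_congr rfl fun n _ => ?_
    simp only [Equiv.trans_apply, Equiv.inv_apply, Equiv.neg_apply]
    by_cases hn : n = 0
    · simp [hn]
    rw [mulChar_one_apply hn, mulChar_one_apply (neg_ne_zero.2 (inv_ne_zero hn)), mul_one, one_mul]
    congr 2
    field_simp
    ring
  -- The substitution `r ↦ r n`.
  have e4 : ∀ n : F, ∑ r, (1 : MulChar F ℂ) n * (a r * ψ (n + r / n + -t ^ 2 * n / r ^ 2)) =
      ∑ r, a (r * n) * ψ (n + r + -t ^ 2 / (r ^ 2 * n)) := by
    intro n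
    by_cases hn : n = 0
    · simp [hn]
    rw [← Equiv.sum_comp (Equiv.mulRight₀ n hn)]
    refine Finset.sum_congr rfl fun r _ => ?_
    rw [Equiv.mulRight₀_apply, mulChar_one_apply hn, one_mul]
    by_cases hr : r = 0
    · simp [hr]
    congr 2
    field_simp
  calc Fintype.card F * (klSum ψ a t * klSum ψ a (-t))
      = ∑ x, ∑ y, ∑ r, ∑ n,
          a r * ψ (n * (x * y) + (1 - t / r) * x + (1 + t / r) * y) * ψ (-(n * r)) := by
        rw [klSum, klSum, Finset.sum_mul_sum, Finset.mul_sum]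
        refine Finset.sum_congr rfl fun x _ => ?_
        rw [Finset.mul_sum]
        exact Finset.sum_congr rfl fun y _ => e1 x y
    _ = ∑ r, ∑ n, ∑ x, ∑ y,
          a r * ψ (n * (x * y) + (1 - t / r) * x + (1 + t / r) * y) * ψ (-(n * r)) := by
        have : ∀ x : F, ∑ y, ∑ r, ∑ n,
            a r * ψ (n * (x * y) + (1 - t / r) * x + (1 + t / r) * y) * ψ (-(n * r)) =
            ∑ r, ∑ n, ∑ y,
            a r * ψ (n * (x * y) + (1 - t / r) * x + (1 + t / r) * y) * ψ (-(n * r)) := fun x => by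
          rw [Finset.sum_comm]
          exact Finset.sum_congr rfl fun r _ => Finset.sum_comm
        simp_rw [this]
        rw [Finset.sum_comm]
        exact Finset.sum_congr rfl fun r _ => Finset.sum_comm
    _ = Fintype.card F * ∑ r, ∑ n,
          (1 : MulChar F ℂ) n * (a r * ψ (n + r / n + -t ^ 2 * n / r ^ 2)) := by
        simp_rw [e2, ← Finset.mul_sum]
        simp_rw [e3]
    _ = Fintype.card F * kummerSum ψ a (-t ^ 2) := by
        rw [Finset.sum_comm]
        simp_rw [e4]
        rfl

/-- The symmetry `y ↦ t / y` of the Kloosterman sum. -/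
theorem klSum_inv (a : MulChar F ℂ) {t : F} (ht : t ≠ 0) :
    klSum ψ a⁻¹ t = (a t)⁻¹ * klSum ψ a t := by
  rw [klSum, klSum, Finset.mul_sum,
    ← Equiv.sum_comp ((Equiv.inv F).trans (Equiv.mulLeft₀ t ht))]
  refine Finset.sum_congr rfl fun y _ => ?_
  simp only [Equiv.trans_apply, Equiv.inv_apply, Equiv.mulLeft₀_apply]
  by_cases hy : y = 0
  · simp [hy]
  rw [map_mul, mulChar_inv_apply, MulChar.inv_apply', inv_inv, mul_assoc]
  congr 3
  field_simp
  ring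

/-- Barnes' first lemma in Mellin form. The hypotheses exclude the degenerate Jacobi sum
`J(1, 1)` and the contribution of the line `x + y = 0`. -/
theorem mulMellin_klSum_mul_klSum (hψ : ψ ≠ 1) {a b : MulChar F ℂ} (hab : a * b ≠ 1) (hne : a ≠ b)
    (ν : MulChar F ℂ) :
    mulMellin (fun t => klSum ψ a t * klSum ψ b t) ν =
      -((a * b) (-1) / Fintype.card F * (gSum ψ ν * gSum ψ (a * b * ν) * gSum ψ (a * ν) *
        gSum ψ (b * ν) * gSum ψ (a * b * ν ^ 2)⁻¹)) := by
  classical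
  -- The inner sum is `∑ t, ν(t) ψ(t (x + y) / (x y))`; on the line `x + y = 0` it is `∑ t, ν(t)`
  -- instead of the value `0` that the general formula would give.
  have e1 : ∀ x y : F, ∑ t, ν t * (a x * ψ (x + t / x) * (b y * ψ (y + t / y))) =
      -gSum ψ ν * ((a * ν) x * (b * ν) y * (ν⁻¹ (x + y) * ψ (x + y))) +
        if y = -x then (a x * b y) * ∑ t, ν t else 0 := by
    intro x y
    by_cases hx : x = 0
    · simp [hx]
    by_cases hy : y = 0
    · simp [hy]
    have e : ∀ t : F, ν t * (a x * ψ (x + t / x) * (b y * ψ (y + t / y))) =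
        a x * b y * ψ (x + y) * (ν t * ψ ((x + y) / (x * y) * t)) := by
      intro t
      have : ψ (x + t / x) * ψ (y + t / y) = ψ (x + y) * ψ ((x + y) / (x * y) * t) := by
        rw [← AddChar.map_add_eq_mul, ← AddChar.map_add_eq_mul]
        congr 1
        field_simp
        ring
      linear_combination (ν t * a x * b y) * this
    simp_rw [e, ← Finset.mul_sum]
    by_cases hxy : y = -x
    · subst hxy
      simp
    · have hs : x + y ≠ 0 := fun h => hxy (eq_neg_of_add_eq_zero_right h)
      have hc := div_ne_zero hs (mul_ne_zero hx hy)
      rw [if_neg hxy, add_zero, sum_mulChar_mul_addChar ν (Or.inr hc),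
        MulChar.mul_apply, MulChar.mul_apply, div_eq_mul_inv, map_mul, MulChar.inv_apply' _ (_)⁻¹,
        inv_inv, map_mul]
      ring
  -- The line contributes a multiple of `∑ x, (a b)(x)`.
  have e2 : ∑ x, ∑ y, (if y = -x then (a x * b y) * ∑ t, ν t else 0) = 0 := by
    simp_rw [Finset.sum_ite_eq', Finset.mem_univ, if_true]
    have : ∀ x, a x * b (-x) * ∑ t, ν t = (a * b) x * (b (-1) * ∑ t, ν t) := fun x => by
      rw [MulChar.mul_apply, mulChar_neg b x]
      ring
    simp_rw [this]
    rw [← Finset.sum_mul, MulChar.sum_eq_zero_of_ne_one hab, zero_mul]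
  have e3 : ∑ x, ∑ y, (a * ν) x * (b * ν) y * (ν⁻¹ (x + y) * ψ (x + y)) =
      -gSum ψ (a * b * ν) * jacobiSum (a * ν) (b * ν) := by
    rw [sum_sum_eq_sum_sum_mul_one_sub _ (fun x => by
      rw [add_neg_cancel, MulChar.map_zero, zero_mul, mul_zero]), gSum, neg_neg, jacobiSum,
      Finset.sum_mul_sum]
    refine Finset.sum_congr rfl fun s _ => Finset.sum_congr rfl fun u _ => ?_
    by_cases hs : s = 0
    · simp [hs]
    rw [mulChar_one_apply hs, ← mul_add, add_sub_cancel, mul_one]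
    simp only [MulChar.mul_apply, map_mul, mulChar_inv_apply]
    field_simp
  have hJ := jacobiSum_eq_gSum_inv hψ (χ := a * ν) (χ' := b * ν) fun h =>
    hne (mul_right_cancel (h.1.trans h.2.symm))
  have e4 : a * ν * (b * ν) = a * b * ν ^ 2 := by rw [mul_mul_mul_comm, sq]
  have e5 : (a * b * ν ^ 2) (-1) = (a * b) (-1) := by
    rw [sq, MulChar.mul_apply, MulChar.mul_apply ν, mulChar_neg_one_sq, mul_one]
  rw [e4, e5] at hJ
  calc mulMellin (fun t => klSum ψ a t * klSum ψ b t) ν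
      = ∑ x, ∑ y, ∑ t, ν t * (a x * ψ (x + t / x) * (b y * ψ (y + t / y))) := by
        simp_rw [mulMellin, klSum, Finset.sum_mul_sum, Finset.mul_sum]
        rw [Finset.sum_comm]
        exact Finset.sum_congr rfl fun r _ => Finset.sum_comm
    _ = -gSum ψ ν * (-gSum ψ (a * b * ν) * jacobiSum (a * ν) (b * ν)) := by
        simp_rw [e1, Finset.sum_add_distrib, e2, add_zero, ← Finset.mul_sum, e3]
    _ = _ := by
        rw [hJ]
        ring

/-- The sum over `y` in `confSum` is a Gauss sum at `1 + t x`; afterwards `x` is replaced by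
`-x / t`. Non-triviality of `b` is needed at `1 + t x = 0`. -/
theorem confSum_eq {b : MulChar F ℂ} (hb : b ≠ 1) (a : MulChar F ℂ) {t : F} (ht : t ≠ 0) :
    confSum ψ a b t =
      -(gSum ψ b * (a (-t))⁻¹ * ∑ x, a x * b⁻¹ (1 - x) * ψ (-(x * t⁻¹))) := by
  have e : ∀ x : F, ∑ y, a x * b y * ψ (x + y + t * (x * y)) =
      -gSum ψ b * (a x * b⁻¹ (1 + t * x) * ψ x) := by
    intro x
    have h := sum_mulChar_mul_addChar (ψ := ψ) b (c := 1 + t * x) (Or.inl hb)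
    calc ∑ y, a x * b y * ψ (x + y + t * (x * y))
        = a x * ψ x * ∑ y, b y * ψ ((1 + t * x) * y) := by
          rw [Finset.mul_sum]
          refine Finset.sum_congr rfl fun y _ => ?_
          rw [show x + y + t * (x * y) = x + (1 + t * x) * y by ring, AddChar.map_add_eq_mul]
          ring
      _ = _ := by rw [h]; ring
  rw [confSum]
  simp_rw [e]
  have ht' : (-t)⁻¹ ≠ 0 := inv_ne_zero (neg_ne_zero.2 ht)
  rw [← Finset.mul_sum, ← Equiv.sum_comp (Equiv.mulLeft₀ _ ht'), neg_mul, mul_assoc,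
    Finset.mul_sum _ _ (a (-t))⁻¹]
  congr 2
  refine Finset.sum_congr rfl fun x _ => ?_
  rw [Equiv.mulLeft₀_apply, map_mul, ← MulChar.inv_apply', mulChar_inv_apply, mul_assoc, mul_assoc,
    mul_assoc]
  congr 4
  · field_simp
    ring
  · field_simp

/-- The double sum to which `confSum a b t * confSum a b (-t)` reduces. -/
noncomputable def dixonSum (ψ : AddChar F ℂ) (a b : MulChar F ℂ) (u : F) : ℂ :=
  ∑ l, ∑ m, b l * a⁻¹ m * (1 : MulChar F ℂ) (l + m) * ψ ((l * m + u) / (l + m))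

/-- Dixon-type product. Both characters of the integrand are expanded as
`-g(a⁻¹) a(w) = ∑ m, a⁻¹(m) ψ(m w)`, which leaves a sum of additive characters over a hyperbolic
form. -/
theorem confSum_mul_confSum_neg (hp : ringChar F ≠ 2) (hψ : ψ ≠ 1) {a b : MulChar F ℂ}
    (ha : a ≠ 1) (hb : b ≠ 1) {t : F} (ht : t ≠ 0) :
    confSum ψ a b t * confSum ψ a b (-t) =
      gSum ψ a * gSum ψ b * (a (t ^ 2))⁻¹ * dixonSum ψ a b (t⁻¹ ^ 2) := by
  have hga := gSum_ne_zero hψ a⁻¹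
  have hτ : t⁻¹ ≠ 0 := inv_ne_zero ht
  set τ := t⁻¹ with hτdef
  have h2 := Ring.two_ne_zero hp
  have ea : ∀ w : F, ∑ m, a⁻¹ m * ψ (m * w) = -(gSum ψ a⁻¹ * a w) := fun w => by
    have := sum_mulChar_mul_addChar (ψ := ψ) a⁻¹ (c := w) (Or.inl (inv_ne_one.2 ha))
    simp_rw [mul_comm w] at this
    rw [this, inv_inv, mul_comm]
  have eb : ∀ w : F, ∑ m, b m * ψ (m * w) = -(gSum ψ b * b⁻¹ w) := fun w => by
    have := sum_mulChar_mul_addChar (ψ := ψ) b (c := w) (Or.inl hb)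
    simp_rw [mul_comm w] at this
    rw [this, mul_comm]
  have e1 : gSum ψ a⁻¹ * gSum ψ b *
      ((∑ x, a x * b⁻¹ (1 - x) * ψ (-(x * τ))) * ∑ y, a y * b⁻¹ (1 - y) * ψ (y * τ)) =
        Fintype.card F * dixonSum ψ a b (τ ^ 2) := by
    -- `m` carries the expansion of `a(x y)`, and `l` that of `b⁻¹((1 - x)(1 - y))`.
    have e : ∀ x y : F, gSum ψ a⁻¹ * gSum ψ b *
        ((a x * b⁻¹ (1 - x) * ψ (-(x * τ))) * (a y * b⁻¹ (1 - y) * ψ (y * τ))) =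
        ∑ l, ∑ m, b l * a⁻¹ m * (ψ l * ψ ((l + m) * (x * y) + -(l + τ) * x + (τ - l) * y)) := by
      intro x y
      have h1 := ea (x * y)
      have h2 := eb ((1 - x) * (1 - y))
      rw [map_mul] at h1 h2
      calc _ = (-(gSum ψ b * (b⁻¹ (1 - x) * b⁻¹ (1 - y)))) * (-(gSum ψ a⁻¹ * (a x * a y))) *
            (ψ (-(x * τ)) * ψ (y * τ)) := by ring
        _ = _ := by
          rw [← h1, ← h2, Finset.sum_mul_sum, Finset.sum_mul]
          refine Finset.sum_congr rfl fun l _ => ?_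
          rw [Finset.sum_mul]
          refine Finset.sum_congr rfl fun m _ => ?_
          have : ψ (l * ((1 - x) * (1 - y))) * ψ (m * (x * y)) * (ψ (-(x * τ)) * ψ (y * τ)) =
              ψ l * ψ ((l + m) * (x * y) + -(l + τ) * x + (τ - l) * y) := by
            simp only [← AddChar.map_add_eq_mul]
            congr 1
            ring
          linear_combination (b l * a⁻¹ m) * this
    have e' : ∀ l m : F, ∑ x, ∑ y,
        b l * a⁻¹ m * (ψ l * ψ ((l + m) * (x * y) + -(l + τ) * x + (τ - l) * y)) =
        Fintype.card F *
          (b l * a⁻¹ m * (1 : MulChar F ℂ) (l + m) * ψ ((l * m + τ ^ 2) / (l + m))) := by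
      intro l m
      simp_rw [← Finset.mul_sum]
      rw [sum_sum_addChar_hyperbolic hψ]
      · by_cases hlm : l + m = 0
        · simp [hlm]
        have : ψ l * ψ (-(-(l + τ) * (τ - l) / (l + m))) = ψ ((l * m + τ ^ 2) / (l + m)) := by
          rw [← AddChar.map_add_eq_mul]
          congr 1
          field_simp
          ring
        rw [← this]
        ring
      · intro _
        by_contra! h
        refine mul_ne_zero h2 hτ ?_
        linear_combination h.2 - h.1
    rw [Finset.sum_mul_sum, Finset.mul_sum]
    simp_rw [Finset.mul_sum, e]
    have : ∀ x : F, ∑ y, ∑ l, ∑ m,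
        b l * a⁻¹ m * (ψ l * ψ ((l + m) * (x * y) + -(l + τ) * x + (τ - l) * y)) =
        ∑ l, ∑ m, ∑ y,
        b l * a⁻¹ m * (ψ l * ψ ((l + m) * (x * y) + -(l + τ) * x + (τ - l) * y)) := fun x => by
      rw [Finset.sum_comm]
      exact Finset.sum_congr rfl fun l _ => Finset.sum_comm
    simp_rw [this]
    rw [Finset.sum_comm, dixonSum, Finset.mul_sum]
    refine Finset.sum_congr rfl fun l _ => ?_
    rw [Finset.sum_comm, Finset.mul_sum]
    exact Finset.sum_congr rfl fun m _ => e' l m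
  have hg := gSum_mul_gSum_inv hψ ha
  have hs0 := mulChar_ne_zero a (x := (-1 : F)) (by simp)
  rw [confSum_eq hb a ht, confSum_eq hb a (neg_ne_zero.2 ht), neg_neg, mulChar_neg a t, inv_neg]
  simp_rw [mul_neg, neg_neg, ← hτdef]
  refine mul_left_cancel₀ (mul_ne_zero hga hs0) ?_
  have hs' : (a (-1))⁻¹ = a (-1) := by rw [← mulChar_inv_apply, mulChar_neg_one_inv]
  rw [map_pow, mul_inv, hs']
  linear_combination (gSum ψ b * (a t)⁻¹ ^ 2 * a (-1) ^ 2) * e1 -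
    (a (-1) * gSum ψ b * (a t)⁻¹ ^ 2 * dixonSum ψ a b (τ ^ 2)) * hg

/-- The Mellin transform of `dixonSum`, with `l = s z`, `m = s (1 - z)`: the sum over `s` is a Gauss
sum and the one over `z` a Jacobi sum, which is not `J(1, 1)` because `a b ≠ 1`. -/
theorem mulMellin_dixonSum (hψ : ψ ≠ 1) {a b : MulChar F ℂ} (hab : a * b ≠ 1) (ν : MulChar F ℂ) :
    mulMellin (dixonSum ψ a b) ν =
      -((a * b) (-1) / Fintype.card F * (gSum ψ ν * gSum ψ (a⁻¹ * b * ν) * gSum ψ (a * ν⁻¹) *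
        gSum ψ (b⁻¹ * ν⁻¹) * gSum ψ (a⁻¹ * b * ν ^ 2))) := by
  have e1 : ∀ l m : F, ∑ u, ν u * (b l * a⁻¹ m * (1 : MulChar F ℂ) (l + m) *
      ψ ((l * m + u) / (l + m))) =
      -gSum ψ ν * (b l * a⁻¹ m * ν (l + m) * ψ (l * m / (l + m))) := by
    intro l m
    by_cases h : l + m = 0
    · simp [h]
    rw [mulChar_one_apply h, mul_one]
    simp_rw [add_div, AddChar.map_add_eq_mul]
    have hm := sum_mulChar_mul_addChar (ψ := ψ) ν (Or.inr (inv_ne_zero h))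
    rw [MulChar.inv_apply', inv_inv] at hm
    calc _ = b l * a⁻¹ m * ψ (l * m / (l + m)) * ∑ u, ν u * ψ ((l + m)⁻¹ * u) := by
          rw [Finset.mul_sum]
          refine Finset.sum_congr rfl fun u _ => ?_
          rw [div_eq_inv_mul u]
          ring
      _ = _ := by rw [hm]; ring
  have e2 : ∑ l, ∑ m, b l * a⁻¹ m * ν (l + m) * ψ (l * m / (l + m)) =
      -gSum ψ (a⁻¹ * b * ν) * jacobiSum (a * ν⁻¹) (b⁻¹ * ν⁻¹) := by
    rw [sum_sum_eq_sum_sum_mul_one_sub _ (fun x => by simp), Finset.sum_comm, jacobiSum,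
      Finset.mul_sum]
    refine Finset.sum_congr rfl fun z _ => ?_
    by_cases hz : z = 0
    · simp [hz]
    by_cases hz1 : 1 - z = 0
    · simp [hz1]
    have hzz := mul_ne_zero hz hz1
    calc _ = b z * a⁻¹ (1 - z) * ∑ s, (a⁻¹ * b * ν) s * ψ (z * (1 - z) * s) := by
          rw [Finset.mul_sum]
          refine Finset.sum_congr rfl fun s _ => ?_
          by_cases hs : s = 0
          · simp [hs]
          have : s * z * (s * (1 - z)) / (s * z + s * (1 - z)) = z * (1 - z) * s := by
            rw [← mul_add, add_sub_cancel, mul_one]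
            field_simp
          rw [this, ← mul_add, add_sub_cancel, mul_one, mulChar_one_apply hs]
          simp only [MulChar.mul_apply, map_mul]
          ring
      _ = _ := by
          rw [sum_mulChar_mul_addChar _ (Or.inr hzz)]
          have h1 := mulChar_ne_zero b hz
          have h2 := mulChar_ne_zero a hz1
          simp only [MulChar.mul_apply, mulChar_inv_apply, map_mul, mul_inv, inv_inv]
          field_simp
  have hJ := jacobiSum_eq_gSum_inv hψ (χ := a * ν⁻¹) (χ' := b⁻¹ * ν⁻¹) fun h => hab (by
    have h3 := mul_right_cancel (h.1.trans h.2.symm)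
    rw [h3, inv_mul_cancel])
  have e4 : (a * ν⁻¹ * (b⁻¹ * ν⁻¹))⁻¹ = a⁻¹ * b * ν ^ 2 := by
    rw [mul_mul_mul_comm, sq]
    simp only [mul_inv, inv_inv]
  have e5 : (a * ν⁻¹ * (b⁻¹ * ν⁻¹)) (-1) = (a * b) (-1) := by
    have := mulChar_neg_one_sq ν
    simp only [MulChar.mul_apply, mulChar_neg_one_inv]
    linear_combination (a (-1) * b (-1)) * this
  rw [e4, e5] at hJ
  calc mulMellin (dixonSum ψ a b) ν
      = ∑ l, ∑ m, ∑ u, ν u * (b l * a⁻¹ m * (1 : MulChar F ℂ) (l + m) *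
          ψ ((l * m + u) / (l + m))) := by
        simp_rw [mulMellin, dixonSum, Finset.mul_sum]
        rw [Finset.sum_comm]
        exact Finset.sum_congr rfl fun r _ => Finset.sum_comm
    _ = -gSum ψ ν * (-gSum ψ (a⁻¹ * b * ν) * jacobiSum (a * ν⁻¹) (b⁻¹ * ν⁻¹)) := by
        simp_rw [e1, ← Finset.mul_sum, e2]
    _ = _ := by
        rw [hJ]
        ring

section Quadratic

variable [DecidableEq F]

theorem sum_addChar_quadratic (hp : ringChar F ≠ 2) (hψ : ψ ≠ 1) {k : F} (hk : k ≠ 0) (β : F) :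
    ∑ x, ψ (k * x ^ 2 + β * x) =
      -(quadChar F k * gSum ψ (quadChar F) * ψ (-(β ^ 2 / (4 * k)))) := by
  have h2 := Ring.two_ne_zero hp
  rw [← neg_mul, ← sum_addChar_sq hp hψ hk, Finset.sum_mul,
    ← Equiv.sum_comp (Equiv.subRight (β / (2 * k)))]
  refine Finset.sum_congr rfl fun x _ => ?_
  rw [← AddChar.map_add_eq_mul, Equiv.subRight_apply]
  congr 1
  have h42 : (4 : F) = 2 * 2 := by norm_num
  rw [h42]
  field_simp
  ring

/-- Kummer's second formula: `confSum a a⁻¹` is an exponential times a Kloosterman sum. -/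
theorem confSum_inv (hp : ringChar F ≠ 2) (hψ : ψ ≠ 1) {a : MulChar F ℂ} (ha : a ≠ 1) {t : F}
    (ht : t ≠ 0) :
    confSum ψ a a⁻¹ t = -(gSum ψ (quadChar F) * quadChar F (-1) * a (-1) * (a (4 * t))⁻¹ *
      ψ (-(t⁻¹ / 2)) * klSum ψ (a⁻¹ * quadChar F) (t⁻¹ ^ 2 / 16)) := by
  have h2 := Ring.two_ne_zero hp
  have h4 := four_ne_zero_of_ringChar hp
  have h16 : (16 : F) = 4 * 4 := by norm_num
  have h42 : (4 : F) = 2 * 2 := by norm_num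
  set τ := t⁻¹
  have ea : ∀ w : F, gSum ψ a⁻¹ * a w = -∑ m, a⁻¹ m * ψ (m * w) := fun w => by
    have := sum_mulChar_mul_addChar (ψ := ψ) a⁻¹ (c := w) (Or.inl (inv_ne_one.2 ha))
    simp_rw [mul_comm w] at this
    rw [this, inv_inv, neg_neg, mul_comm]
  -- `a(x (1 - x))` is expanded in additive characters.
  have e1 : gSum ψ a⁻¹ * ∑ x, a x * a⁻¹⁻¹ (1 - x) * ψ (-(x * τ)) =
      -∑ m, ∑ x, a⁻¹ m * ψ (-m * x ^ 2 + (m - τ) * x) := by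
    rw [Finset.sum_comm, Finset.mul_sum, ← Finset.sum_neg_distrib]
    refine Finset.sum_congr rfl fun x _ => ?_
    rw [inv_inv, ← map_mul, ← mul_assoc, ea, neg_mul, Finset.sum_mul]
    congr 1
    refine Finset.sum_congr rfl fun m _ => ?_
    rw [mul_assoc, ← AddChar.map_add_eq_mul]
    congr 2
    ring
  -- The quadratic sum over `x`, for `m = 4 y`.
  have e2 : ∀ y : F, ∑ x, a⁻¹ (4 * y) * ψ (-(4 * y) * x ^ 2 + (4 * y - τ) * x) =
      -(gSum ψ (quadChar F) * quadChar F (-1) * (a 4)⁻¹ * ψ (-(τ / 2))) *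
        ((a⁻¹ * quadChar F) y * ψ (y + τ ^ 2 / 16 / y)) := by
    intro y
    by_cases hy : y = 0
    · simp [hy]
    have hy4 : -(4 * y) ≠ 0 := neg_ne_zero.2 (mul_ne_zero h4 hy)
    have hφ : quadChar F (-(4 * y)) = quadChar F (-1) * quadChar F y := by
      rw [mulChar_neg, map_mul, h42, map_mul, quadChar_apply_mul_self hp h2, one_mul]
    have hψ' : ψ (-((4 * y - τ) ^ 2 / (4 * -(4 * y)))) = ψ (-(τ / 2)) * ψ (y + τ ^ 2 / 16 / y) := by
      rw [← AddChar.map_add_eq_mul, h16, h42]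
      congr 1
      field_simp
      ring
    rw [← Finset.mul_sum, sum_addChar_quadratic hp hψ hy4, hφ, hψ', MulChar.mul_apply, map_mul,
      mulChar_inv_apply a 4]
    ring
  have e3 : ∑ m, ∑ x, a⁻¹ m * ψ (-m * x ^ 2 + (m - τ) * x) =
      -(gSum ψ (quadChar F) * quadChar F (-1) * (a 4)⁻¹ * ψ (-(τ / 2))) *
        klSum ψ (a⁻¹ * quadChar F) (τ ^ 2 / 16) := by
    rw [← Equiv.sum_comp (Equiv.mulLeft₀ (4 : F) h4), klSum, Finset.mul_sum]
    exact Finset.sum_congr rfl fun y _ => e2 y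
  have hs : (a (-1))⁻¹ = a (-1) := by rw [← mulChar_inv_apply, mulChar_neg_one_inv]
  rw [confSum_eq (inv_ne_one.2 ha) a ht, mul_right_comm, e1, e3, mulChar_neg a t, map_mul a 4,
    mul_inv, hs, mul_inv]
  ring

end Quadratic

end ProductIdentities

/-! ### Product formulas for hypergeometric functions -/

section ProductFormulas

variable {F : Type*} [Field F] [Fintype F] {ψ : AddChar F ℂ}

variable [DecidableEq F]

/-- To compare two characters it is enough to compare them up to powers of `φ * φ`. -/
theorem eq_of_eq_mul_quadChar_zpow (hp : ringChar F ≠ 2) {χ χ' : MulChar F ℂ} (k : ℤ)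
    (h : χ = χ' * (quadChar F * quadChar F) ^ k) : χ = χ' := by
  rw [h, quadChar_mul_self hp, one_zpow, mul_one]

/-- Duplication for Pochhammer symbols. -/
theorem poch_mul_poch_quadChar (hp : ringChar F ≠ 2) (hψ : ψ ≠ 1) (γ ν : MulChar F ℂ) :
    poch ψ γ ν * poch ψ (γ * quadChar F) ν * ν 4 = poch ψ (γ ^ 2) (ν ^ 2) := by
  have h4 := four_ne_zero_of_ringChar hp
  have h1 := gSum_duplication hp hψ γ
  have h2 := gSum_duplication hp hψ (γ * ν)
  rw [MulChar.mul_apply, mul_pow, mul_right_comm γ ν] at h2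
  have n1 := gSum_ne_zero hψ γ
  have n2 := gSum_ne_zero hψ (γ * quadChar F)
  have n3 := gSum_ne_zero hψ (γ ^ 2)
  have n4 := gSum_ne_zero hψ (quadChar F)
  have n5 := mulChar_ne_zero γ h4
  rw [poch, poch, poch]
  field_simp
  refine mul_left_cancel₀ (mul_ne_zero n5 n4) ?_
  linear_combination (gSum ψ (γ ^ 2) * gSum ψ (quadChar F)) * h2 -
    (gSum ψ (γ ^ 2 * ν ^ 2) * gSum ψ (quadChar F)) * h1

/-- Duplication for the denominator parameters `ε` and `φ`. -/
theorem inv_pochO_one_mul_quadChar (hp : ringChar F ≠ 2) (hψ : ψ ≠ 1) (ν : MulChar F ℂ) :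
    (pochO ψ 1 ν)⁻¹ * (pochO ψ (quadChar F) ν)⁻¹ = ν 4 * gSum ψ (ν⁻¹ ^ 2) := by
  have h1 := gSum_duplication hp hψ ν⁻¹
  have hφ := gSum_quadChar_sq hp hψ
  have hs := mulChar_neg_one_sq ν
  have hs' := mulChar_neg_one_sq (quadChar F)
  have h4 := mulChar_ne_zero ν (four_ne_zero_of_ringChar hp)
  rw [mulChar_inv_apply, inv_mul_eq_iff_eq_mul₀ h4] at h1
  rw [inv_pochO_one hψ, inv_pochO hψ, gSumO_of_ne_one (quadChar_ne_one hp), quadChar_inv hp,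
    mul_comm (quadChar F) ν⁻¹]
  field_simp
  linear_combination (gSum ψ (quadChar F) * quadChar F (-1) * ν (-1) ^ 2) * h1 +
    (ν (-1) ^ 2 * quadChar F (-1) * ν 4 * gSum ψ (ν⁻¹ ^ 2)) * hφ +
    (ν (-1) ^ 2 * ν 4 * gSum ψ (ν⁻¹ ^ 2) * Fintype.card F) * hs' +
    (ν 4 * gSum ψ (ν⁻¹ ^ 2) * Fintype.card F) * hs

/-- Duplication for `g°`. It fails for `a = 1`, where `g°(a²)` has a factor `q` more than the
right-hand side. -/
theorem gSumO_duplication (hp : ringChar F ≠ 2) (hψ : ψ ≠ 1) {a : MulChar F ℂ} (ha : a ≠ 1) :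
    gSumO ψ (a ^ 2) * gSum ψ (quadChar F) = a 4 * (gSum ψ a * gSumO ψ (a * quadChar F)) := by
  rw [gSumO, gSumO, charDelta_sq hp, charDelta_of_ne_one ha, zero_add]
  linear_combination (-(Fintype.card F : ℂ) ^ charDelta (a * quadChar F)) *
    gSum_duplication hp hψ a

/-- Kummer's second formula `₁F₁(a; a²; x) = ψ(-x/2) ₀F₁(aφ; x²/16)`. -/
theorem rFs_one_one_sq (hp : ringChar F ≠ 2) (hψ : ψ ≠ 1) {a : MulChar F ℂ} (ha : a ≠ 1) {x : F}
    (hx : x ≠ 0) :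
    rFs ψ {a} {a ^ 2} x = ψ (-(x / 2)) * rFs ψ 0 {a * quadChar F} (x ^ 2 / 16) := by
  have h4 := four_ne_zero_of_ringChar hp
  have h16 : (16 : F) = 4 * 4 := by norm_num
  have hx2 : x ^ 2 / 16 ≠ 0 := div_ne_zero (pow_ne_zero 2 hx) (by rw [h16]; exact mul_ne_zero h4 h4)
  have e1 : a * (a ^ 2)⁻¹ = a⁻¹ := by rw [sq, mul_inv, mul_inv_cancel_left]
  have e2 : (a * quadChar F)⁻¹ = a⁻¹ * quadChar F := by rw [mul_inv, quadChar_inv hp]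
  have hd := gSumO_duplication hp hψ ha
  have n1 := gSum_ne_zero hψ a
  have n2 := mulChar_ne_zero a hx
  have n3 := mulChar_ne_zero a h4
  rw [rFs_one_one hψ a (a ^ 2) hx, e1, confSum_inv hp hψ ha (inv_ne_zero hx), inv_inv,
    rFs_zero_one hψ _ hx2, e2, mulChar_sq_neg_one, map_mul, ← MulChar.inv_apply' a,
    mulChar_inv_apply a x, MulChar.mul_apply]
  field_simp
  linear_combination (-ψ (-(x / 2)) * quadChar F (-1) * a (-1) *
    klSum ψ (a⁻¹ * quadChar F) (x ^ 2 / 16)) * hd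

/-- The product of two `₀F₁`, from Barnes' first lemma. -/
theorem rFs_zero_one_mul_rFs_zero_one (hp : ringChar F ≠ 2) (hψ : ψ ≠ 1) {a b c γ : MulChar F ℂ}
    (hab : a * b = c) (hγ : γ ^ 2 = c) (hc1 : c ≠ 1) (hne : a ≠ b) {y : F} (hy : y ≠ 0) :
    rFs ψ 0 {a} y * rFs ψ 0 {b} y = rFs ψ {γ, γ * quadChar F} {a, b, c} (4 * y) := by
  subst hab
  have hg := gSum_ne_zero hψ (a * b)
  have key := sum_mulMellin_inv_mul (fun t => klSum ψ a⁻¹ t * klSum ψ b⁻¹ t) hy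
  have e : ∀ ν : MulChar F ℂ, pochP ψ {γ, γ * quadChar F} ν / pochPO ψ ({1} + {a, b, a * b}) ν *
      ν (4 * y) = -(gSumO ψ a * gSumO ψ b * (a * b) (-1) / Fintype.card F ^ 2) *
        (mulMellin (fun t => klSum ψ a⁻¹ t * klSum ψ b⁻¹ t) ν⁻¹ * ν y) := by
    intro ν
    have hd := poch_mul_poch_quadChar hp hψ γ ν
    have e1 : (a⁻¹ * b⁻¹ * ν⁻¹ ^ 2)⁻¹ = a * b * ν ^ 2 := by
      simp only [mul_inv, inv_inv, inv_pow]
    have e2 : (a⁻¹ * b⁻¹) (-1) = (a * b) (-1) := by rw [← mul_inv, mulChar_neg_one_inv]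
    have hs := mulChar_neg_one_sq ν
    simp only [pochP, pochPO, Multiset.insert_eq_cons, Multiset.map_cons, Multiset.prod_cons,
      Multiset.map_add, Multiset.map_singleton, Multiset.prod_add, Multiset.prod_singleton]
    rw [mulMellin_klSum_mul_klSum hψ (by rwa [← mul_inv, inv_ne_one])
        (fun h => hne (inv_injective h)), e1, e2,
      div_eq_mul_inv _ (_ * _)]
    have hs4 : ν (-1) ^ 4 = 1 := by linear_combination (ν (-1) ^ 2 + 1) * hs
    have hd' : gSum ψ (a * b) * (poch ψ γ ν * poch ψ (γ * quadChar F) ν * ν 4) =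
        gSum ψ (a * b * ν ^ 2) := by
      rw [hd, hγ, poch, mul_div_cancel₀ _ hg]
    simp only [mul_inv (pochO _ _ _)]
    rw [inv_pochO_one hψ, inv_pochO hψ, inv_pochO hψ, inv_pochO hψ, gSumO_of_ne_one hc1, map_mul ν,
      mul_inv a b, MulChar.mul_apply]
    linear_combination (gSumO ψ a * gSumO ψ b * a (-1) ^ 2 * b (-1) ^ 2 * gSum ψ (a⁻¹ * ν⁻¹) *
      gSum ψ (b⁻¹ * ν⁻¹) * gSum ψ (a⁻¹ * b⁻¹ * ν⁻¹) * gSum ψ ν⁻¹ * ν y / Fintype.card F ^ 3) *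
      (ν (-1) ^ 4 * hd' + gSum ψ (a * b * ν ^ 2) * hs4)
  rw [rFs_zero_one hψ _ hy, rFs_zero_one hψ _ hy, rFs, hypF_eq_sum]
  simp_rw [e]
  rw [← Finset.mul_sum, key, one_div_one_sub_card_mul, MulChar.mul_apply]
  ring

/-- The product of two `₀F₁` with inverse parameters and opposite arguments. -/
theorem rFs_zero_one_mul_rFs_zero_one_neg (hp : ringChar F ≠ 2) (hψ : ψ ≠ 1) (α : MulChar F ℂ)
    {x : F} (hx : x ≠ 0) :
    rFs ψ 0 {α ^ 2} x * rFs ψ 0 {(α ^ 2)⁻¹} (-x) =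
      (Fintype.card F : ℂ) ^ charDelta α *
        rFs ψ 0 {quadChar F, α * quadChar F, α⁻¹ * quadChar F} (-(x ^ 2 / 4)) := by
  have h4 := four_ne_zero_of_ringChar hp
  have hx2 : -x ^ 2 ≠ 0 := neg_ne_zero.2 (pow_ne_zero 2 hx)
  have hα1 := mulChar_neg_one_sq α
  have hφ1 := mulChar_neg_one_sq (quadChar F)
  have key := sum_mulMellin_inv_mul (kummerSum ψ (α ^ 2)) hx2
  -- Substituting `ν = α⁻¹ φ μ` makes the coefficients those of `kummerSum`.
  have e : ∀ μ : MulChar F ℂ, pochP ψ 0 (α⁻¹ * quadChar F * μ) /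
      pochPO ψ ({1} + {quadChar F, α * quadChar F, α⁻¹ * quadChar F}) (α⁻¹ * quadChar F * μ) *
        (α⁻¹ * quadChar F * μ) (-(x ^ 2 / 4)) =
      -(gSumO ψ (α * quadChar F) * gSumO ψ (α⁻¹ * quadChar F) / Fintype.card F ^ 2 *
        (α (-1) * quadChar F (-1)) * (α x ^ 2)⁻¹) *
        (mulMellin (kummerSum ψ (α ^ 2)) μ⁻¹ * μ (-x ^ 2)) := by
    intro μ
    set ν := α⁻¹ * quadChar F * μ with hν
    have c1 : ν⁻¹ ^ 2 = α ^ 2 * μ⁻¹ ^ 2 := eq_of_eq_mul_quadChar_zpow hp (-1)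
      (Additive.ofMul.injective (by
        simp only [hν, ofMul_mul, ofMul_inv, ofMul_pow, ofMul_zpow]; abel))
    have c2 : (α * quadChar F)⁻¹ * ν⁻¹ = μ⁻¹ := eq_of_eq_mul_quadChar_zpow hp (-1)
      (Additive.ofMul.injective (by
        simp only [hν, ofMul_mul, ofMul_inv, ofMul_zpow]; abel))
    have c3 : (α⁻¹ * quadChar F)⁻¹ * ν⁻¹ = α ^ 2 * μ⁻¹ := eq_of_eq_mul_quadChar_zpow hp (-1)
      (Additive.ofMul.injective (by
        simp only [hν, ofMul_mul, ofMul_inv, ofMul_pow, ofMul_zpow]; abel))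
    have hd := inv_pochO_one_mul_quadChar hp hψ ν
    have hs := mulChar_neg_one_sq ν
    have hν4 : ν 4 * ν (-(x ^ 2 / 4)) = ν (-x ^ 2) := by
      rw [← map_mul]
      congr 1
      field_simp
    have hνx : ν (-x ^ 2) = α (-1) * quadChar F (-1) * (α x ^ 2)⁻¹ * μ (-x ^ 2) := by
      have : quadChar F (x ^ 2) = 1 := by rw [sq, map_mul, quadChar_apply_mul_self hp hx]
      rw [hν, MulChar.mul_apply, MulChar.mul_apply, mulChar_neg _ (x ^ 2), mulChar_neg _ (x ^ 2),
        mulChar_neg_one_inv, this, mulChar_inv_apply, map_pow]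
      ring
    simp only [pochP, pochPO, Multiset.insert_eq_cons, Multiset.map_cons, Multiset.prod_cons,
      Multiset.map_add, Multiset.map_singleton, Multiset.prod_add, Multiset.prod_singleton,
      Multiset.map_zero, Multiset.prod_zero]
    rw [one_div]
    simp only [mul_inv (pochO _ _ _)]
    rw [← mul_assoc (pochO ψ 1 ν)⁻¹, hd, inv_pochO hψ, inv_pochO hψ, mulMellin_kummerSum, c1, c2,
      c3, MulChar.mul_apply α, MulChar.mul_apply α⁻¹, mulChar_neg_one_inv]
    linear_combination (gSumO ψ (α * quadChar F) * gSumO ψ (α⁻¹ * quadChar F) /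
      Fintype.card F ^ 2 * gSum ψ (α ^ 2 * μ⁻¹ ^ 2) * gSum ψ μ⁻¹ * gSum ψ (α ^ 2 * μ⁻¹)) *
      (α (-1) ^ 2 * quadChar F (-1) ^ 2 * ν (-1) ^ 2 * (hν4 + hνx) +
        (α (-1) * quadChar F (-1) * (α x ^ 2)⁻¹ * μ (-x ^ 2)) *
          (α (-1) ^ 2 * quadChar F (-1) ^ 2 * hs + α (-1) ^ 2 * hφ1 + hα1))
  have hδ := charDelta_sq hp α
  have hg1 := gSumO_mul_gSumO_inv hψ (α ^ 2)
  have hg2 := gSumO_mul_gSumO_inv hψ (α * quadChar F)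
  rw [mul_inv α, quadChar_inv hp, MulChar.mul_apply] at hg2
  rw [mulChar_sq_neg_one, hδ, pow_add] at hg1
  rw [rFs_zero_one hψ _ hx, rFs_zero_one hψ _ (neg_ne_zero.2 hx), inv_inv, klSum_inv _ hx,
    mulChar_neg_one_inv, mulChar_sq_neg_one, rFs, hypF_eq_sum,
    ← Equiv.sum_comp (Equiv.mulLeft (α⁻¹ * quadChar F))]
  simp only [Equiv.coe_mulLeft]
  simp_rw [e]
  rw [← Finset.mul_sum, key, one_div_one_sub_card_mul, ← klSum_mul_klSum_neg hp hψ,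
    MulChar.pow_apply' α two_ne_zero]
  linear_combination (klSum ψ (α ^ 2) x * klSum ψ (α ^ 2) (-x) / Fintype.card F ^ 2 *
    (α x ^ 2)⁻¹) * (hg1 - (α (-1) * quadChar F (-1)) * (Fintype.card F : ℂ) ^ charDelta α * hg2 -
      (Fintype.card F : ℂ) * (Fintype.card F : ℂ) ^ charDelta α *
        (Fintype.card F : ℂ) ^ charDelta (α * quadChar F) * (quadChar F (-1) ^ 2 * hα1 + hφ1))

/-- After the substitution `ν = (a μ)⁻¹` the coefficients of this `₄F₁` are, up to a constant, the
Mellin transform of `dixonSum a b`. -/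
theorem rFs_four_one_eq_dixonSum (hp : ringChar F ≠ 2) (hψ : ψ ≠ 1) {a b c γ : MulChar F ℂ}
    (hab : a * b = c) (hγ : γ ^ 2 = c) (hc1 : c ≠ 1) {x : F} (hx : x ≠ 0) :
    rFs ψ {a, b, γ, γ * quadChar F} {c} (4 * x ^ 2) =
      (a (x ^ 2))⁻¹ * dixonSum ψ a b (x⁻¹ ^ 2) / (gSum ψ a * gSum ψ b) := by
  subst hab
  have hg := gSum_ne_zero hψ (a * b)
  have key := sum_mulMellin_inv_mul (dixonSum ψ a b) (pow_ne_zero 2 (inv_ne_zero hx))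
  have e : ∀ μ : MulChar F ℂ, pochP ψ {a, b, γ, γ * quadChar F} (a⁻¹ * μ⁻¹) /
      pochPO ψ ({1} + {a * b}) (a⁻¹ * μ⁻¹) * (a⁻¹ * μ⁻¹) (4 * x ^ 2) =
      -((a (x ^ 2))⁻¹ / (gSum ψ a * gSum ψ b)) *
        (mulMellin (dixonSum ψ a b) μ⁻¹ * μ (x⁻¹ ^ 2)) := by
    intro μ
    set ν := a⁻¹ * μ⁻¹ with hν
    have c1 : a * ν = μ⁻¹ := mul_inv_cancel_left a _
    have c2 : b * ν = a⁻¹ * b * μ⁻¹ := by rw [hν, mul_left_comm, mul_assoc]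
    have c3 : ν⁻¹ = a * μ := by rw [hν, mul_inv, inv_inv, inv_inv]
    have c4 : (a * b)⁻¹ * (a * μ) = b⁻¹ * μ := Additive.ofMul.injective (by
        simp only [ofMul_mul, ofMul_inv]; abel)
    have c5 : a * b * ν ^ 2 = a⁻¹ * b * μ⁻¹ ^ 2 := Additive.ofMul.injective (by
        simp only [hν, ofMul_mul, ofMul_inv, ofMul_pow]; abel)
    have hd := poch_mul_poch_quadChar hp hψ γ ν
    rw [hγ, poch_def (a * b), c5, eq_div_iff hg] at hd
    have hs := mulChar_neg_one_sq ν
    have hνx : ν (x ^ 2) = (a (x ^ 2))⁻¹ * μ (x⁻¹ ^ 2) := by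
      rw [hν, MulChar.mul_apply, mulChar_inv_apply, MulChar.inv_apply' μ, inv_pow]
    simp only [pochP, pochPO, Multiset.insert_eq_cons, Multiset.map_cons, Multiset.prod_cons,
      Multiset.map_add, Multiset.map_singleton, Multiset.prod_add, Multiset.prod_singleton]
    rw [div_eq_mul_inv _ (_ * _)]
    simp only [mul_inv (pochO _ _ _)]
    rw [inv_pochO_one hψ, inv_pochO hψ, mulMellin_dixonSum hψ hc1, poch_def a, poch_def b,
      gSumO_of_ne_one hc1, inv_inv, c1, c2, c3, c4, map_mul ν, hνx]
    linear_combination (gSum ψ μ⁻¹ / gSum ψ a * (gSum ψ (a⁻¹ * b * μ⁻¹) / gSum ψ b) *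
      gSum ψ (a * μ) * gSum ψ (b⁻¹ * μ) * (a * b) (-1) / Fintype.card F *
        ((a (x ^ 2))⁻¹ * μ (x⁻¹ ^ 2))) *
      (ν (-1) ^ 2 * hd + gSum ψ (a⁻¹ * b * μ⁻¹ ^ 2) * hs)
  rw [rFs, hypF_eq_sum, ← Equiv.sum_comp ((Equiv.inv _).trans (Equiv.mulLeft a⁻¹))]
  simp only [Equiv.trans_apply, Equiv.inv_apply, Equiv.coe_mulLeft]
  simp_rw [e]
  rw [← Finset.mul_sum, key, one_div_one_sub_card_mul]
  ring

/-- The product of two `₂F₀` with equal parameters and opposite arguments. -/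
theorem rFs_two_zero_mul_rFs_two_zero_neg (hp : ringChar F ≠ 2) (hψ : ψ ≠ 1)
    {a b c γ : MulChar F ℂ} (hab : a * b = c) (hγ : γ ^ 2 = c) (ha : a ≠ 1) (hb : b ≠ 1)
    (hc1 : c ≠ 1) {x : F} (hx : x ≠ 0) :
    rFs ψ {a, b} 0 x * rFs ψ {a, b} 0 (-x) =
      rFs ψ {a, b, γ, γ * quadChar F} {c} (4 * x ^ 2) := by
  have hE := confSum_mul_confSum_neg hp hψ ha hb hx
  rw [rFs_four_one_eq_dixonSum hp hψ hab hγ hc1 hx, rFs_two_zero hψ a b hx,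
    rFs_two_zero hψ a b (neg_ne_zero.2 hx), neg_neg, div_mul_div_comm, mul_comm (confSum _ _ _ _),
    hE]
  field_simp

/-- The product of two `₁F₁` with parameters `a; β²` and `aβ⁻²; β⁻²` and opposite arguments. -/
theorem rFs_one_one_mul_rFs_one_one_neg (hp : ringChar F ≠ 2) (hψ : ψ ≠ 1) {a β : MulChar F ℂ}
    (ha : a ≠ 1) (hab : a ≠ β ^ 2) (hab2 : a ^ 2 ≠ β ^ 2) {x : F} (hx : x ≠ 0) :
    rFs ψ {a} {β ^ 2} x * rFs ψ {a * (β ^ 2)⁻¹} {(β ^ 2)⁻¹} (-x) =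
      (Fintype.card F : ℂ) ^ charDelta β *
        rFs ψ {a * β⁻¹ * quadChar F, a⁻¹ * β * quadChar F}
          {quadChar F, β * quadChar F, β⁻¹ * quadChar F} (x ^ 2 / 4) := by
  have h4 := four_ne_zero_of_ringChar hp
  have hx2 : x ^ 2 ≠ 0 := pow_ne_zero 2 hx
  have hax := mulChar_ne_zero a hx
  have hβx := mulChar_ne_zero β hx
  have hβ1 := mulChar_neg_one_sq β
  have hφ1 := mulChar_neg_one_sq (quadChar F)
  have hb : a * (β ^ 2)⁻¹ ≠ 1 := fun h => hab (mul_inv_eq_one.1 h)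
  have habm : a * (a * (β ^ 2)⁻¹) ≠ 1 := fun h => hab2 (by
    rwa [← mul_assoc, mul_inv_eq_one, ← sq] at h)
  have hne : a * β⁻¹ * quadChar F ≠ 1 := fun h => hab2 (by
    rw [mul_assoc, mul_comm β⁻¹, ← mul_assoc, mul_inv_eq_one] at h
    rw [← h, mul_pow, (quadChar_spec F hp).1, mul_one])
  set b := a * (β ^ 2)⁻¹ with hbdef
  have hga := gSum_ne_zero hψ a
  have hgb := gSum_ne_zero hψ b
  have key := sum_mulMellin_inv_mul (dixonSum ψ a b) hx2
  -- Substituting `ν = β φ μ` makes the coefficients those of `dixonSum`.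
  have e : ∀ μ : MulChar F ℂ,
      pochP ψ {a * β⁻¹ * quadChar F, a⁻¹ * β * quadChar F} (β * quadChar F * μ) /
      pochPO ψ ({1} + {quadChar F, β * quadChar F, β⁻¹ * quadChar F}) (β * quadChar F * μ) *
        (β * quadChar F * μ) (x ^ 2 / 4) =
      -(gSumO ψ (β * quadChar F) * gSumO ψ (β⁻¹ * quadChar F) * β x ^ 2 /
        (Fintype.card F * gSum ψ (a * β⁻¹ * quadChar F) * gSum ψ (a⁻¹ * β * quadChar F))) *
        (mulMellin (dixonSum ψ a b) μ⁻¹ * μ (x ^ 2)) := by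
    intro μ
    set ν := β * quadChar F * μ with hν
    have c1 : a * β⁻¹ * quadChar F * ν = a * μ := eq_of_eq_mul_quadChar_zpow hp 1
      (Additive.ofMul.injective (by
        simp only [hν, ofMul_mul, ofMul_inv, ofMul_zpow]; abel))
    have c2 : a⁻¹ * β * quadChar F * ν = b⁻¹ * μ := eq_of_eq_mul_quadChar_zpow hp 1
      (Additive.ofMul.injective (by
        simp only [hν, hbdef, ofMul_mul, ofMul_inv, ofMul_pow, ofMul_zpow]; abel))
    have c3 : (β * quadChar F)⁻¹ * ν⁻¹ = a⁻¹ * b * μ⁻¹ := eq_of_eq_mul_quadChar_zpow hp (-1)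
      (Additive.ofMul.injective (by
        simp only [hν, hbdef, ofMul_mul, ofMul_inv, ofMul_pow, ofMul_zpow]; abel))
    have c4 : (β⁻¹ * quadChar F)⁻¹ * ν⁻¹ = μ⁻¹ := eq_of_eq_mul_quadChar_zpow hp (-1)
      (Additive.ofMul.injective (by
        simp only [hν, ofMul_mul, ofMul_inv, ofMul_zpow]; abel))
    have c5 : ν⁻¹ ^ 2 = a⁻¹ * b * μ⁻¹ ^ 2 := eq_of_eq_mul_quadChar_zpow hp (-1)
      (Additive.ofMul.injective (by
        simp only [hν, hbdef, ofMul_mul, ofMul_inv, ofMul_pow, ofMul_zpow]; abel))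
    have c6 : (a * b) (-1) = 1 := by
      rw [show a * b = (a * β⁻¹) ^ 2 from Additive.ofMul.injective (by
        simp only [hbdef, ofMul_mul, ofMul_inv, ofMul_pow]; abel), mulChar_sq_neg_one]
    have hd := inv_pochO_one_mul_quadChar hp hψ ν
    have hs := mulChar_neg_one_sq ν
    have hν4 : ν 4 * ν (x ^ 2 / 4) = ν (x ^ 2) := by
      rw [← map_mul]
      congr 1
      field_simp
    have hνx : ν (x ^ 2) = β x ^ 2 * μ (x ^ 2) := by
      have : quadChar F (x ^ 2) = 1 := by rw [sq, map_mul, quadChar_apply_mul_self hp hx]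
      rw [hν, MulChar.mul_apply, MulChar.mul_apply, this, map_pow]
      ring
    simp only [pochP, pochPO, Multiset.insert_eq_cons, Multiset.map_cons, Multiset.prod_cons,
      Multiset.map_add, Multiset.map_singleton, Multiset.prod_add, Multiset.prod_singleton]
    rw [div_eq_mul_inv _ (_ * _)]
    simp only [mul_inv (pochO _ _ _)]
    rw [← mul_assoc (pochO ψ 1 ν)⁻¹, hd, inv_pochO hψ, inv_pochO hψ, mulMellin_dixonSum hψ habm,
      poch, poch, inv_inv, c1, c2, c3, c4, c5, c6, MulChar.mul_apply β,
      MulChar.mul_apply β⁻¹, mulChar_neg_one_inv]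
    linear_combination (gSumO ψ (β * quadChar F) * gSumO ψ (β⁻¹ * quadChar F) /
      Fintype.card F ^ 2 * gSum ψ (a⁻¹ * b * μ⁻¹ ^ 2) * gSum ψ μ⁻¹ * gSum ψ (a⁻¹ * b * μ⁻¹) *
      (gSum ψ (a * μ) / gSum ψ (a * β⁻¹ * quadChar F)) *
      (gSum ψ (b⁻¹ * μ) / gSum ψ (a⁻¹ * β * quadChar F))) *
      (β (-1) ^ 2 * quadChar F (-1) ^ 2 * ν (-1) ^ 2 * (hν4 + hνx) +
        (β x ^ 2 * μ (x ^ 2)) *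
          (β (-1) ^ 2 * quadChar F (-1) ^ 2 * hs + β (-1) ^ 2 * hφ1 + hβ1))
  have hδ := charDelta_sq hp β
  have hgβ := gSumO_mul_gSumO_inv hψ (β ^ 2)
  have hgβφ := gSumO_mul_gSumO_inv hψ (β * quadChar F)
  have hgg := gSum_mul_gSum_inv hψ hne
  rw [mul_inv β, quadChar_inv hp, MulChar.mul_apply] at hgβφ
  rw [mul_inv _ (quadChar F), mul_inv a, inv_inv, quadChar_inv hp, MulChar.mul_apply,
    MulChar.mul_apply, mulChar_neg_one_inv] at hgg
  rw [mulChar_sq_neg_one, hδ, pow_add] at hgβ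
  have hE := confSum_mul_confSum_neg hp hψ ha hb (inv_ne_zero hx)
  rw [inv_inv, map_pow, ← MulChar.inv_apply', mulChar_inv_apply] at hE
  have hbb : b * (β ^ 2)⁻¹⁻¹ = a := by rw [inv_inv, hbdef, inv_mul_cancel_right]
  have hbx : b (-x) = a (-1) * a x * (β x ^ 2)⁻¹ := by
    rw [hbdef, MulChar.mul_apply, mulChar_inv_apply, mulChar_neg (β ^ 2) x, mulChar_sq_neg_one,
      one_mul, mulChar_neg a x, MulChar.pow_apply' β two_ne_zero]
  have ha1 := mulChar_neg_one_sq a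
  have ha1' : (a (-1))⁻¹ = a (-1) := by rw [← mulChar_inv_apply, mulChar_neg_one_inv]
  rw [rFs_one_one hψ _ _ hx, rFs_one_one hψ _ _ (neg_ne_zero.2 hx), ← hbdef, hbb, inv_neg,
    confSum_comm b a, mulChar_neg_one_inv, mulChar_sq_neg_one, hbx, mul_inv, mul_inv, ha1', inv_inv]
  rw [rFs, hypF_eq_sum, ← Equiv.sum_comp (Equiv.mulLeft (β * quadChar F))]
  simp only [Equiv.coe_mulLeft]
  simp_rw [e]
  rw [← Finset.mul_sum, key, one_div_one_sub_card_mul]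
  have hc1 := mulChar_ne_zero a (x := (-1 : F)) (by simp)
  have hc2 := mulChar_ne_zero β (x := (-1 : F)) (by simp)
  have hc3 := mulChar_ne_zero (quadChar F) (x := (-1 : F)) (by simp)
  have hL : gSumO ψ (β ^ 2) * 1 / (Fintype.card F * gSum ψ a) * (a x)⁻¹ * confSum ψ a b x⁻¹ *
      (gSumO ψ (β ^ 2)⁻¹ * 1 / (Fintype.card F * gSum ψ b) * (a (-1) * (a x)⁻¹ * β x ^ 2) *
        confSum ψ a b (-x⁻¹)) =
      gSumO ψ (β ^ 2) * gSumO ψ (β ^ 2)⁻¹ * (confSum ψ a b x⁻¹ * confSum ψ a b (-x⁻¹)) *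
        (a (-1) * (a x)⁻¹ ^ 2 * β x ^ 2) /
          (Fintype.card F ^ 2 * gSum ψ a * gSum ψ b) := by ring
  have hR : (Fintype.card F : ℂ) ^ charDelta β * -(-(gSumO ψ (β * quadChar F) *
      gSumO ψ (β⁻¹ * quadChar F) * β x ^ 2 / (Fintype.card F * gSum ψ (a * β⁻¹ * quadChar F) *
        gSum ψ (a⁻¹ * β * quadChar F))) * dixonSum ψ a b (x ^ 2)) =
      (Fintype.card F : ℂ) ^ charDelta β * (gSumO ψ (β * quadChar F) *
        gSumO ψ (β⁻¹ * quadChar F)) * β x ^ 2 * dixonSum ψ a b (x ^ 2) /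
          (Fintype.card F * (gSum ψ (a * β⁻¹ * quadChar F) * gSum ψ (a⁻¹ * β * quadChar F))) := by
    ring
  rw [hL, hR, hgβ, hE, hgβφ, hgg]
  field_simp
  linear_combination dixonSum ψ a b (x ^ 2) * ha1

/-- The product of two `₂F₀` with parameters `α², α⁻²` and `β², β⁻²` and opposite arguments. -/
theorem rFs_two_zero_inv_mul_rFs_two_zero_inv_neg (hp : ringChar F ≠ 2) (hψ : ψ ≠ 1)
    {α β : MulChar F ℂ} (hα : α ^ 2 ≠ 1) (hβ : β ^ 2 ≠ 1) (hαβ : α ^ 2 * β ^ 2 ≠ 1)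
    (hne : α ^ 2 ≠ β ^ 2) {x : F} (hx : x ≠ 0) :
    rFs ψ {α ^ 2, (α ^ 2)⁻¹} 0 x * rFs ψ {β ^ 2, (β ^ 2)⁻¹} 0 (-x) =
      rFs ψ {α * β⁻¹ * quadChar F, α⁻¹ * β * quadChar F, α * β, (α * β)⁻¹} {quadChar F}
        (4 * x ^ 2) := by
  have hc := card_ne_zero_complex (F := F)
  have h4 := four_ne_zero_of_ringChar hp
  have h16 : (16 : F) = 4 * 4 := by norm_num
  have hY : x⁻¹ ^ 2 / 16 ≠ 0 := div_ne_zero (pow_ne_zero 2 (inv_ne_zero hx))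
    (by rw [h16]; exact mul_ne_zero h4 h4)
  have hφ := gSum_quadChar_sq hp hψ
  have hφ1 := mulChar_neg_one_sq (quadChar F)
  have hα1 := mulChar_neg_one_sq α
  have hβ1 := mulChar_neg_one_sq β
  have hne1 : α * β⁻¹ * quadChar F ≠ 1 := fun h => hne (by
    rw [mul_assoc, mul_comm β⁻¹, ← mul_assoc, mul_inv_eq_one] at h
    rw [← h, mul_pow, (quadChar_spec F hp).1, mul_one])
  have hne2 : α * β ≠ 1 := fun h => hαβ (by rw [← mul_pow, h, one_pow])
  have hg1 := gSum_mul_gSum_inv hψ hne1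
  have hg2 := gSum_mul_gSum_inv hψ hne2
  rw [mul_inv _ (quadChar F), mul_inv α, inv_inv, quadChar_inv hp, MulChar.mul_apply,
    MulChar.mul_apply, mulChar_neg_one_inv] at hg1
  rw [MulChar.mul_apply] at hg2
  set a := (α ^ 2)⁻¹ * quadChar F with ha
  set b := (β ^ 2)⁻¹ * quadChar F with hb
  have hab : a * b = (α ^ 2)⁻¹ * (β ^ 2)⁻¹ := eq_of_eq_mul_quadChar_zpow hp 1
      (Additive.ofMul.injective (by
        simp only [ha, hb, ofMul_mul, ofMul_inv, ofMul_pow, ofMul_zpow]; abel))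
  have hab1 : a * b ≠ 1 := by rwa [hab, ← mul_inv, inv_ne_one]
  have hanb : a ≠ b := fun h => hne (inv_injective (mul_right_cancel h))
  have habn : (a * b) (-1) = 1 := by
    rw [hab, ← mul_inv, ← mul_pow, mulChar_neg_one_inv, mulChar_sq_neg_one]
  have key := sum_mulMellin_inv_mul (fun t => klSum ψ a t * klSum ψ b t) hY
  -- Substituting `ν = (α β μ)⁻¹` makes the coefficients those of the Barnes type product.
  have e : ∀ μ : MulChar F ℂ,
      pochP ψ {α * β⁻¹ * quadChar F, α⁻¹ * β * quadChar F, α * β, (α * β)⁻¹}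
        ((α * β)⁻¹ * μ⁻¹) / pochPO ψ ({1} + {quadChar F}) ((α * β)⁻¹ * μ⁻¹) *
        ((α * β)⁻¹ * μ⁻¹) (4 * x ^ 2) =
      -(Fintype.card F * (α (4 * x) ^ 2 * β (4 * x) ^ 2)⁻¹ /
        (gSum ψ (α * β⁻¹ * quadChar F) * gSum ψ (α⁻¹ * β * quadChar F) *
          (gSum ψ (α * β) * gSum ψ (α * β)⁻¹))) *
        (mulMellin (fun t => klSum ψ a t * klSum ψ b t) μ⁻¹ * μ (x⁻¹ ^ 2 / 16)) := by
    intro μ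
    set ν := (α * β)⁻¹ * μ⁻¹ with hν
    have c1 : α * β⁻¹ * quadChar F * ν = b * μ⁻¹ := Additive.ofMul.injective (by
        simp only [hν, hb, ofMul_mul, ofMul_inv, ofMul_pow]; abel)
    have c2 : α⁻¹ * β * quadChar F * ν = a * μ⁻¹ := Additive.ofMul.injective (by
        simp only [hν, ha, ofMul_mul, ofMul_inv, ofMul_pow]; abel)
    have c3 : α * β * ν = μ⁻¹ := mul_inv_cancel_left _ _
    have c4 : (α * β)⁻¹ * ν = a * b * μ⁻¹ := Additive.ofMul.injective (by
        simp only [hν, hab, ofMul_mul, ofMul_inv, ofMul_pow]; abel)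
    have c5 : ν⁻¹ ^ 2 = (a * b * μ⁻¹ ^ 2)⁻¹ := Additive.ofMul.injective (by
        simp only [hν, hab, ofMul_mul, ofMul_inv, ofMul_pow]; abel)
    have hd := inv_pochO_one_mul_quadChar hp hψ ν
    have hν4 : ν 4 * ν (4 * x ^ 2) =
        (α (4 * x) ^ 2 * β (4 * x) ^ 2)⁻¹ * μ (x⁻¹ ^ 2 / 16) := by
      have h1 : x⁻¹ ^ 2 / 16 = ((4 * x) ^ 2)⁻¹ := by
        rw [h16]
        field_simp
      have h2 : 4 * (4 * x ^ 2) = (4 * x) ^ 2 := by ring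
      rw [← map_mul, h1, h2, hν, MulChar.mul_apply, mulChar_inv_apply, MulChar.inv_apply' μ,
        MulChar.mul_apply, map_pow, map_pow β]
    simp only [pochP, pochPO, Multiset.insert_eq_cons, Multiset.map_cons, Multiset.prod_cons,
      Multiset.map_add, Multiset.map_singleton, Multiset.prod_add, Multiset.prod_singleton]
    rw [div_eq_mul_inv _ (_ * _)]
    simp only [mul_inv (pochO _ _ _)]
    rw [hd, mulMellin_klSum_mul_klSum hψ hab1 hanb, poch, poch, poch, poch, c1, c2, c3, c4, c5,
      habn]
    have hqq : (Fintype.card F : ℂ) * (1 / Fintype.card F) = 1 := mul_one_div_cancel hc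
    linear_combination (gSum ψ (b * μ⁻¹) / gSum ψ (α * β⁻¹ * quadChar F) *
      (gSum ψ (a * μ⁻¹) / gSum ψ (α⁻¹ * β * quadChar F)) * (gSum ψ μ⁻¹ / gSum ψ (α * β)) *
      (gSum ψ (a * b * μ⁻¹) / gSum ψ (α * β)⁻¹) * gSum ψ (a * b * μ⁻¹ ^ 2)⁻¹) *
      (hν4 - (α (4 * x) ^ 2 * β (4 * x) ^ 2)⁻¹ * μ (x⁻¹ ^ 2 / 16) * hqq)
  have hLa := confSum_inv hp hψ hα (neg_ne_zero.2 hx)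
  have hLb := confSum_inv hp hψ hβ hx
  rw [inv_neg, neg_sq] at hLa
  have hψψ : ψ (-(-x⁻¹ / 2)) * ψ (-(x⁻¹ / 2)) = 1 := by
    rw [← AddChar.map_add_eq_mul, neg_div, neg_neg, add_neg_cancel, AddChar.map_zero_eq_one]
  have hga := gSum_mul_gSum_inv hψ hα
  have hgb := gSum_mul_gSum_inv hψ hβ
  rw [mulChar_sq_neg_one, one_mul] at hga hgb
  rw [rFs_two_zero hψ _ _ hx, rFs_two_zero hψ _ _ (neg_ne_zero.2 hx), neg_neg, hga, hgb, hLa, hLb,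
    mul_neg, mulChar_neg _ (4 * x), mulChar_sq_neg_one, mulChar_sq_neg_one, ← ha, ← hb,
    MulChar.pow_apply' α two_ne_zero, MulChar.pow_apply' β two_ne_zero]
  rw [rFs, hypF_eq_sum, ← Equiv.sum_comp ((Equiv.inv _).trans (Equiv.mulLeft (α * β)⁻¹))]
  simp only [Equiv.trans_apply, Equiv.inv_apply, Equiv.coe_mulLeft]
  simp_rw [e]
  rw [← Finset.mul_sum, key, one_div_one_sub_card_mul, hg1, hg2]
  have hc1 := mulChar_ne_zero α (x := (-1 : F)) (by simp)
  have hc2 := mulChar_ne_zero β (x := (-1 : F)) (by simp)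
  have hc3 := mulChar_ne_zero (quadChar F) (x := (-1 : F)) (by simp)
  have hL : ∀ A B K L s t : ℂ, -(gSum ψ (quadChar F) * quadChar F (-1) * 1 * (1 * A)⁻¹ * s * K) /
      (Fintype.card F : ℂ) * (-(gSum ψ (quadChar F) * quadChar F (-1) * 1 * B⁻¹ * t * L) /
        (Fintype.card F : ℂ)) = gSum ψ (quadChar F) * gSum ψ (quadChar F) *
        (quadChar F (-1) * quadChar F (-1)) * (s * t) * (A * B)⁻¹ * (K * L) /
          (Fintype.card F : ℂ) ^ 2 := by
    intro A B K L s t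
    rw [mul_inv A]
    ring
  rw [hL, hφ, hφ1, hψψ]
  generalize klSum ψ a (x⁻¹ ^ 2 / 16) = K
  generalize klSum ψ b (x⁻¹ ^ 2 / 16) = L
  field_simp
  linear_combination (K * L * (α (4 * x) ^ 2 * β (4 * x) ^ 2)⁻¹) *
    (quadChar F (-1) ^ 2 * α (-1) ^ 2 * hβ1 + quadChar F (-1) ^ 2 * hα1 + hφ1)

end ProductFormulas

/-! ### The pairing of parameter sets and the product formulas -/

theorem ne_one_of_pairing {F : Type*} [Field F] {a b c : MulChar F ℂ}
    (h : pairing {a, b, c} {1} = 0) : a ≠ 1 ∧ b ≠ 1 ∧ c ≠ 1 := by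
  simpa [pairing, charDelta_eq_zero_iff] using h

theorem ne_of_pairing {F : Type*} [Field F] {a b : MulChar F ℂ}
    (h : pairing {a} {b} = 0) : a ≠ b := by
  simpa [pairing, charDelta_eq_zero_iff, mul_inv_eq_one] using h

theorem ne_and_ne_of_pairing {F : Type*} [Field F] {a b c : MulChar F ℂ}
    (h : pairing {a} {b, c} = 0) : a ≠ b ∧ a ≠ c := by
  simpa [pairing, charDelta_eq_zero_iff, mul_inv_eq_one] using h

/-- The product of `₁F₁(a; a²)` and `₁F₁(b; b²)` at opposite arguments: the exponential factors of
Kummer's second formula cancel. -/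
theorem rFs_one_one_sq_mul_rFs_one_one_sq_neg {F : Type*} [Field F] [Fintype F] [DecidableEq F]
    {ψ : AddChar F ℂ} (hp : ringChar F ≠ 2) (hψ : ψ ≠ 1) {a b a' b' c γ : MulChar F ℂ}
    (ha' : a * quadChar F = a') (hb' : b * quadChar F = b') (hab : a * b = c) (hγ : γ ^ 2 = c)
    (ha : a ≠ 1) (hb : b ≠ 1) (hc : c ≠ 1) (hne : a ≠ b) {x : F} (hx : x ≠ 0) :
    rFs ψ {a} {a ^ 2} x * rFs ψ {b} {b ^ 2} (-x) =
      rFs ψ {γ, γ * quadChar F} {a', b', c} (x ^ 2 / 4) := by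
  subst ha' hb'
  have h4 := four_ne_zero_of_ringChar hp
  have h16 : (16 : F) = 4 * 4 := by norm_num
  have hx2 : x ^ 2 / 16 ≠ 0 := div_ne_zero (pow_ne_zero 2 hx) (by rw [h16]; exact mul_ne_zero h4 h4)
  have hab' : a * quadChar F * (b * quadChar F) = c := by
    rw [mul_mul_mul_comm, quadChar_mul_self hp, mul_one, hab]
  have hψψ : ψ (-(x / 2)) * ψ (-(-x / 2)) = 1 := by
    rw [← AddChar.map_add_eq_mul, neg_div, neg_neg, neg_add_cancel, AddChar.map_zero_eq_one]
  have hy : x ^ 2 / 4 = 4 * (x ^ 2 / 16) := by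
    rw [h16]
    field_simp
  rw [rFs_one_one_sq hp hψ ha hx, rFs_one_one_sq hp hψ hb (neg_ne_zero.2 hx), neg_sq,
    mul_mul_mul_comm, hψψ, one_mul, hy]
  exact rFs_zero_one_mul_rFs_zero_one hp hψ hab' hγ hc (fun h => hne (mul_right_cancel h)) hx2

theorem mainTheorem3 {F : Type*} [Field F] [Fintype F] [DecidableEq F]
    (hp : ringChar F ≠ 2) (ψ : AddChar F ℂ) (hψ : ψ ≠ 1) :
    -- (i)
    (∀ (α : MulChar F ℂ) (x : F),
      rFs ψ 0 {α ^ 2} x * rFs ψ 0 {(α ^ 2)⁻¹} (-x) =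
        (Fintype.card F : ℂ) ^ charDelta α * rFs ψ 0 {quadChar F, α * quadChar F, α⁻¹ * quadChar F} (-(x ^ 2 / 4))) ∧
    -- (ii)
    (∀ α β : MulChar F ℂ, pairing {α ^ 2, β ^ 2, α ^ 2 * β ^ 2} {1} = 0 → ∀ x : F,
      rFs ψ {α ^ 2, β ^ 2} 0 x * rFs ψ {α ^ 2, β ^ 2} 0 (-x) =
        rFs ψ {α ^ 2, β ^ 2, α * β, α * β * quadChar F} {α ^ 2 * β ^ 2} (4 * x ^ 2)) ∧
    -- (iii)
    (∀ α β : MulChar F ℂ, pairing {α ^ 2, β ^ 2, α ^ 2 * β ^ 2} {1} = 0 →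
      pairing {α ^ 2} {β ^ 2} = 0 → ∀ x : F,
      rFs ψ {α ^ 2, (α ^ 2)⁻¹} 0 x * rFs ψ {β ^ 2, (β ^ 2)⁻¹} 0 (-x) =
        rFs ψ {α * β⁻¹ * quadChar F, α⁻¹ * β * quadChar F, α * β, (α * β)⁻¹} {quadChar F} (4 * x ^ 2)) ∧
    -- (iv)
    (∀ α β : MulChar F ℂ, pairing {α} {1, β ^ 2} = 0 →
      pairing {α ^ 2} {β ^ 2} = 0 → ∀ x : F,
      rFs ψ {α} {β ^ 2} x * rFs ψ {α * (β ^ 2)⁻¹} {(β ^ 2)⁻¹} (-x) =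
        (Fintype.card F : ℂ) ^ charDelta β *
          rFs ψ {α * β⁻¹ * quadChar F, α⁻¹ * β * quadChar F} {quadChar F, β * quadChar F, β⁻¹ * quadChar F} (x ^ 2 / 4)) ∧
    -- (v), first formula
    (∀ α β : MulChar F ℂ, pairing {α ^ 2, β ^ 2, α ^ 2 * β ^ 2} {1} = 0 →
      pairing {α ^ 2} {β ^ 2} = 0 → ∀ x : F,
      rFs ψ {α ^ 2} {α ^ 4} x * rFs ψ {β ^ 2} {β ^ 4} (-x) =
        rFs ψ {α * β, α * β * quadChar F} {α ^ 2 * quadChar F, β ^ 2 * quadChar F, α ^ 2 * β ^ 2} (x ^ 2 / 4)) ∧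
    -- (v), second formula
    (∀ α β : MulChar F ℂ, pairing {α ^ 2 * quadChar F, β ^ 2 * quadChar F, α ^ 2 * β ^ 2} {1} = 0 →
      pairing {α ^ 2} {β ^ 2} = 0 → ∀ x : F,
      rFs ψ {α ^ 2 * quadChar F} {α ^ 4} x * rFs ψ {β ^ 2 * quadChar F} {β ^ 4} (-x) =
        rFs ψ {α * β, α * β * quadChar F} {α ^ 2, β ^ 2, α ^ 2 * β ^ 2} (x ^ 2 / 4)) := by

  have hφ := quadChar_mul_self hp
  refine ⟨fun α x => ?_, fun α β h x => ?_, fun α β h h' x => ?_, fun α β h h' x => ?_,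
    fun α β h h' x => ?_, fun α β h h' x => ?_⟩
  -- At `x = 0` every series vanishes, since all characters do.
  all_goals
    by_cases hx : x = 0
    · subst hx
      simp [rFs_zero]
  · exact rFs_zero_one_mul_rFs_zero_one_neg hp hψ α hx
  · obtain ⟨h1, h2, h3⟩ := ne_one_of_pairing h
    exact rFs_two_zero_mul_rFs_two_zero_neg hp hψ rfl (mul_pow α β 2) h1 h2 h3 hx
  · obtain ⟨h1, h2, h3⟩ := ne_one_of_pairing h
    exact rFs_two_zero_inv_mul_rFs_two_zero_inv_neg hp hψ h1 h2 h3 (ne_of_pairing h') hx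
  · obtain ⟨h1, h2⟩ := ne_and_ne_of_pairing h
    exact rFs_one_one_mul_rFs_one_one_neg hp hψ h1 h2 (ne_of_pairing h') hx
  · obtain ⟨h1, h2, h3⟩ := ne_one_of_pairing h
    have e : ∀ χ : MulChar F ℂ, χ ^ 4 = (χ ^ 2) ^ 2 := fun χ => pow_mul χ 2 2
    rw [e α, e β]
    exact rFs_one_one_sq_mul_rFs_one_one_sq_neg hp hψ rfl rfl rfl (mul_pow α β 2) h1 h2 h3
      (ne_of_pairing h') hx
  · obtain ⟨h1, h2, h3⟩ := ne_one_of_pairing h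
    -- The lower parameters are again the squares of the upper ones, as `φ² = 1`.
    have e : ∀ χ : MulChar F ℂ, χ ^ 4 = (χ ^ 2 * quadChar F) ^ 2 := fun χ => by
      rw [mul_pow, (quadChar_spec F hp).1, mul_one, ← pow_mul]
    have e' : ∀ χ : MulChar F ℂ, χ * quadChar F * quadChar F = χ := fun χ => by
      rw [mul_assoc, hφ, mul_one]
    rw [e α, e β]
    exact rFs_one_one_sq_mul_rFs_one_one_sq_neg hp hψ (e' _) (e' _)
      (by rw [mul_mul_mul_comm, hφ, mul_one]) (mul_pow α β 2) h1 h2 h3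
      (fun h => ne_of_pairing h' (mul_right_cancel h)) hx
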